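/- Identify $\mathbb R^5$ with the space of symmetric trace-free real $3\times 3$ matrices by $$\mu(x)=\begin{pmatrix}\frac{x_1}{\sqrt3}-x_4&x_2&x_3\\x_2&\frac{x_1}{\sqrt3}+x_4&x_5\\x_3&x_5&-\frac{2x_1}{\sqrt3}\end{pmatrix},$$ and let $\iota(SO(3))\subset SO(5)$ be the image of the irreducible representation $\mu(\iota(h)x)=h\,\mu(x)\,h^{-1}$. Let $M$ be a non-empty smooth $5$-manifold with an irreducible $SO(3)$-structure, i.e. a reduction of the structure group of $TM$ to $\iota(SO(3))$. The frames $(E_1,\dots,E_5)$ of this reduction are called adapted; they define a Riemannian metric $g$ and an orientation of $M$, and a symmetric $3$-tensor $\Upsilon$ with $\Upsilon(x,x,x)=\frac{3\sqrt3}{2}\det\mu(x)$ in adapted frames. Put $g(\Upsilon_v x,y)=\Upsilon(v,x,y)$. Let $\Lambda^2_3TM\subset\otimes^2TM$ be the rank $3$ bundle of those $F$ with $4\sum_j\Upsilon_{F(E_j)}\circ\Upsilon_{E_j}=7F$, where $F$ is viewed as an endomorphism by $g(F(x),y)=g(F,x\otimes y)$; it is contained in $\Lambda^2TM$, which carries the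 metric $g(x\wedge y,u\wedge v)=g(x,u)g(y,v)-g(x,v)g(y,u)$. It is oriented by the bases $\kappa_1=\sqrt3E_1\wedge E_5+E_2\wedge E_3+E_4\wedge E_5$, $\kappa_2=\sqrt3E_1\wedge E_3+E_2\wedge E_5+E_3\wedge E_4$, $\kappa_3=2E_2\wedge E_4+E_3\wedge E_5$, where $|\kappa_i|^2=5$. Let $\times$ be the vector product on the fibres of $\Lambda^2_3TM$ normalized by $\kappa_1\times\kappa_2=\kappa_3$. Let $\pi:\mathbb T=\{\sigma\in\Lambda^2_3TM:|\sigma|^2=5\}\to M$ be the twistor space, let $\nabla$ be any (smooth) $SO(3)$-connection on $M$, i.e. a covariant derivative on $TM$ induced by a connection on the bundle of adapted frames, and let $T\mathbb T=\mathcal H\oplus\mathcal V$ be the decomposition into the horizontal bundle of $\nabla$ and the vertical bundle; $X^h_\sigma\in\mathcal H_\sigma$ denotes the horizontal lift of $X\in T_{\pi(\sigma)}M$. For $\sigma\in\mathbb T$ put $\xi_\sigma=\frac14*(\sigma\wedge\sigma)\in T_{\pi(\sigma)}M$, let $H^\sigma=\xi_\sigma^\perp$ be oriented so that $\mathbb R\xi_\sigma\oplus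 H^\sigma$ has the orientation of $T_{\pi(\sigma)}M$, and let $\sigma_\pm$ be the self-dual and anti-self-dual components of $\sigma\in\Lambda^2H^\sigma$. Define the endomorphism $\varphi^\sigma_\pm$ of $T_{\pi(\sigma)}M$ by $$g(\varphi_\pm^\sigma X,Y)=\frac{2}{2\pm1}\,g(\sigma_\pm,X\wedge Y);\qquad \varphi^\sigma_\pm\xi_\sigma=0 .$$ For $n\in\{1,2\}$ and $t>0$ define on $\mathbb T$ $$\Phi^{(n)}_\pm X^h_\sigma=(\varphi^\sigma_\pm X)^h_\sigma,\qquad \Phi^{(n)}_\pm V=(-1)^n\sigma\times V\quad(V\in\mathcal V_\sigma),\qquad \chi_\sigma=(\xi_\sigma)^h_\sigma,$$ $$h_t(X^h_\sigma+V,Y^h_\sigma+W)=g(X,Y)+t\,g(V,W),\qquad \eta=h_t(\cdot,\chi).$$ An almost contact structure $(\varphi,\xi,\eta)$ on a manifold $N$ is called normal if the almost complex structure $J(X,f\frac{d}{ds})=(\varphi X-f\xi,\ \eta(X)\frac{d}{ds})$ on $N\times S^1$ is integrable, i.e. has vanishing Nijenhuis tensor. **Proposition.** For every such $M$, every $SO(3)$-connection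 $\nabla$ on $M$ and every $t>0$, none of the three almost contact metric structures $(\Phi^{(1)}_-,\chi,h_t)$, $(\Phi^{(2)}_+,\chi,h_t)$ and $(\Phi^{(2)}_-,\chi,h_t)$ on $\mathbb T$ is normal. -/

import Mathlib

open Bundle Module
open scoped Manifold ContDiff Topology InnerProductSpace Matrix

namespace SO3Twistor
noncomputable section

abbrev E3 := EuclideanSpace ℝ (Fin 3)
abbrev E5 := EuclideanSpace ℝ (Fin 5)
abbrev End5 := E5 →L[ℝ] E5

/-- The standard basis `e_0, …, e_4` of `ℝ⁵`. -/
def stdVec (i : Fin 5) : E5 := EuclideanSpace.single i 1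

/-- The identification of `ℝ⁵` with the symmetric trace-free `3 × 3` matrices. -/
def mu (x : E5) : Matrix (Fin 3) (Fin 3) ℝ :=
  !![x 0 / √3 - x 3, x 1, x 2;
     x 1, x 0 / √3 + x 3, x 4;
     x 2, x 4, -2 * (x 0 / √3)]

/-- `a` belongs to the image `ι(SO(3))` of the irreducible representation of `SO(3)` on `ℝ⁵`,
which is conjugation of symmetric trace-free matrices: `μ (a v) = h μ(v) h⁻¹` for some `h ∈ SO(3)`. -/
def IsIota (a : E5 ≃L[ℝ] E5) : Prop :=
  ∃ h ∈ Matrix.specialOrthogonalGroup (Fin 3) ℝ, ∀ v : E5, mu (a v) = h * mu v * h⁻¹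

/-- `L` belongs to the Lie algebra of `ι(SO(3))`: `μ (L v) = [B, μ(v)]` for some `B ∈ so(3)`. -/
def IsIotaLie (L : E5 → E5) : Prop :=
  ∃ B : Matrix (Fin 3) (Fin 3) ℝ, Bᵀ = -B ∧ ∀ v : E5, mu (L v) = B * mu v - mu v * B

/-- The invariant cubic polynomial `Υ(x, x, x) = (3√3 / 2) det μ(x)`. -/
def upsilonCubic (x : E5) : ℝ :=
  1 / 2 * x 0 * (6 * x 1 ^ 2 + 6 * x 3 ^ 2 - 2 * x 0 ^ 2 - 3 * x 2 ^ 2 - 3 * x 4 ^ 2)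
    + 3 * √3 / 2 * x 3 * (x 4 ^ 2 - x 2 ^ 2) + 3 * √3 * x 1 * x 2 * x 4

/-- The symmetric `3`-form `Υ` obtained by polarization. -/
def upsilon (x y z : E5) : ℝ :=
  (upsilonCubic (x + y + z) - upsilonCubic (x + y) - upsilonCubic (y + z) - upsilonCubic (x + z)
    + upsilonCubic x + upsilonCubic y + upsilonCubic z) / 6

/-- The endomorphism `Υ_v` of `ℝ⁵`, `⟨Υ_v x, y⟩ = Υ(v, x, y)`. -/
def upsilonOp (v x : E5) : E5 := WithLp.toLp 2 fun k => upsilon v x (stdVec k)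

/-- `Υ̂(F)(x) = 4 ∑ⱼ Υ_{F e_j} (Υ_{e_j} x)`. Elements of `⊗² ℝ⁵` are treated as endomorphisms through
`⟨F x, y⟩ = ⟨F, x ⊗ y⟩`. -/
def upsilonHat (F : End5) (x : E5) : E5 :=
  (4 : ℝ) • ∑ j, upsilonOp (F (stdVec j)) (upsilonOp (stdVec j) x)

/-- The summand `Λ²₃` of `⊗² ℝ⁵`: the eigenspace of `Υ̂` for the eigenvalue `7`. -/
def lambda23 : Set End5 := {F | ∀ x, upsilonHat F x = (7 : ℝ) • F x}

/-- The metric of `Λ² ℝ⁵` in which `|x ∧ y|² = |x|² |y|² - ⟨x, y⟩²`, written for skew endomorphisms. -/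
def ip (A B : End5) : ℝ := 1 / 2 * ∑ i, ⟪A (stdVec i), B (stdVec i)⟫_ℝ

/-- The `2`-vector `a ∧ b` as an endomorphism: `x ↦ ⟨a, x⟩ b - ⟨b, x⟩ a`. -/
def wedge (a b : E5) : End5 := (innerSL ℝ a).smulRight b - (innerSL ℝ b).smulRight a

/-- The basis `κ₁ = √3 e₁∧e₅ + e₂∧e₃ + e₄∧e₅`, `κ₂ = √3 e₁∧e₃ + e₂∧e₅ + e₃∧e₄`,
`κ₃ = 2 e₂∧e₄ + e₃∧e₅` of `Λ²₃` (indices starting from `1` here). -/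
def kappaBasis : Fin 3 → End5 :=
  ![√3 • wedge (stdVec 0) (stdVec 4) + wedge (stdVec 1) (stdVec 2) + wedge (stdVec 3) (stdVec 4),
    √3 • wedge (stdVec 0) (stdVec 2) + wedge (stdVec 1) (stdVec 4) + wedge (stdVec 2) (stdVec 3),
    (2 : ℝ) • wedge (stdVec 1) (stdVec 3) + wedge (stdVec 2) (stdVec 4)]

/-- `κ(y) = y₁ κ₁ + y₂ κ₂ + y₃ κ₃`. -/
def kappa (y : E3) : End5 := ∑ i, y i • kappaBasis i

/-- The coordinates `y_i = ⟨σ, κ_i⟩ / 5` of an element of `Λ²₃`. -/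
def kappaCoord (A : End5) : E3 := WithLp.toLp 2 fun i => ip A (kappaBasis i) / 5

lemma mu_injective : Function.Injective mu := by
  intro x y h
  have h3 : √3 ≠ 0 := by positivity
  have e (i j) : mu x i j = mu y i j := by rw [h]
  have e00 := e 0 0; have e01 := e 0 1; have e02 := e 0 2; have e12 := e 1 2; have e22 := e 2 2
  simp [mu] at e00 e01 e02 e12 e22
  ext i
  fin_cases i <;> simp_all

/-- The skew matrix by which `κ(y)` acts on symmetric trace-free matrices. -/
def skew (y : E3) : Matrix (Fin 3) (Fin 3) ℝ :=
  !![0, -y 2, -y 1; y 2, 0, -y 0; y 1, y 0, 0]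

lemma kappa_apply (y : E3) (v : E5) : kappa y v = WithLp.toLp 2
    ![-(√3 * y 0 * v 4 + √3 * y 1 * v 2),
      -(y 0 * v 2 + y 1 * v 4 + 2 * y 2 * v 3),
      √3 * y 1 * v 0 + y 0 * v 1 - y 1 * v 3 - y 2 * v 4,
      2 * y 2 * v 1 + y 1 * v 2 - y 0 * v 4,
      √3 * y 0 * v 0 + y 1 * v 1 + y 2 * v 2 + y 0 * v 3] := by
  ext i
  fin_cases i <;>
  simp [kappa, kappaBasis, wedge, stdVec, Fin.sum_univ_three,
    EuclideanSpace.inner_single_left] <;> ring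

lemma mu_kappa (y : E3) (v : E5) : mu (kappa y v) = skew y * mu v - mu v * skew y := by
  have h3 : √3 ≠ 0 := by positivity
  have h3' : √3 ^ 2 = 3 := by norm_num
  rw [kappa_apply]
  ext i j
  fin_cases i <;> fin_cases j <;>
  simp [mu, skew, Matrix.sub_apply] <;> field_simp <;> ring_nf <;> simp [h3'] <;> ring

lemma ip_kappa (y z : E3) : ip (kappa y) (kappa z) = 5 * ⟪y, z⟫_ℝ := by
  have h3' : √3 ^ 2 = 3 := by norm_num
  simp [ip, kappa_apply, PiLp.inner_apply, Fin.sum_univ_five, Fin.sum_univ_three, stdVec]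
  ring_nf
  simp [h3']; ring

lemma kappaCoord_kappa (y : E3) : kappaCoord (kappa y) = y := by
  ext i
  have : kappaBasis i = kappa (EuclideanSpace.single i 1) := by
    simp only [kappa, Fin.sum_univ_three]
    fin_cases i <;> simp [zero_smul ℝ (_ : End5)]
  simp [kappaCoord, this, ip_kappa, EuclideanSpace.inner_single_right]

lemma upsilonOp_eq (v x : E5) : upsilonOp v x = WithLp.toLp 2
    ![-(v 0 * x 0) + v 1 * x 1 + v 3 * x 3 - v 2 * x 2 / 2 - v 4 * x 4 / 2,
      v 0 * x 1 + v 1 * x 0 + √3 / 2 * (v 2 * x 4 + v 4 * x 2),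
      -(v 0 * x 2 + v 2 * x 0) / 2 - √3 / 2 * (v 2 * x 3 + v 3 * x 2)
        + √3 / 2 * (v 1 * x 4 + v 4 * x 1),
      v 0 * x 3 + v 3 * x 0 + √3 / 2 * (v 4 * x 4 - v 2 * x 2),
      -(v 0 * x 4 + v 4 * x 0) / 2 + √3 / 2 * (v 3 * x 4 + v 4 * x 3)
        + √3 / 2 * (v 1 * x 2 + v 2 * x 1)] := by
  ext i
  fin_cases i <;> simp [upsilonOp, upsilon, upsilonCubic, stdVec] <;> ring

lemma kappa_mem (y : E3) : kappa y ∈ lambda23 := by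
  have h3' : √3 ^ 2 = 3 := by norm_num
  intro v
  rw [kappa_apply]
  ext i
  fin_cases i <;>
  simp [upsilonHat, kappa_apply, upsilonOp_eq, Fin.sum_univ_five, stdVec] <;>
  ring_nf <;> simp [h3'] <;> ring

set_option maxHeartbeats 1000000 in
lemma eq_kappa_of_mem {F : End5} (hF : F ∈ lambda23) :
    ∃ y, F = kappa y := by
  have h3' : √3 ^ 2 = 3 := by norm_num
  have key (k m : Fin 5) : upsilonHat F (stdVec k) m = 7 * F (stdVec k) m := by
    rw [hF]; simp
  refine ⟨WithLp.toLp 2 ![F (stdVec 1) 2, F (stdVec 1) 4, F (stdVec 1) 3 / 2], ?_⟩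
  simp only [upsilonHat, upsilonOp_eq, Fin.sum_univ_five] at key
  have aux : ∀ k, F (stdVec k) = kappa (WithLp.toLp 2 ![F (stdVec 1) 2, F (stdVec 1) 4, F (stdVec 1) 3 / 2]) (stdVec k) := by
    simp only [kappa_apply]
    generalize hf : (fun k => F (stdVec k)) = f at *
    have hf' (k) : F (stdVec k) = f k := by rw [← hf]
    simp only [hf'] at key ⊢
    generalize √3 = s at *
    simp [Fin.forall_fin_succ, stdVec] at key
    obtain ⟨⟨a1, a2, a3, a4, a5⟩, ⟨b1, b2, b3, b4, b5⟩, ⟨c1, c2, c3, c4, c5⟩,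
      ⟨d1, d2, d3, d4, d5⟩, ⟨e1, e2, e3, e4, e5⟩⟩ := key
    intro k
    ext m
    fin_cases k <;> fin_cases m
    · simp [stdVec]
      linear_combination (-6/35)*a1 + (1/35)*b2 + (9/70)*c3 + (1/35)*d4 + (9/70)*e5 +
        ((-9/35)*f 1 1+(-11/35)*f 2 2+(-9/35)*f 3 3+(-11/35)*f 4 4)*h3'
    · simp [stdVec]
      linear_combination (-2/15)*a2 + (-1/15)*b1 + ((1/15)*s)*b4 + ((1/15)*s)*c5 +
        ((-1/15)*s)*d2 + ((1/15)*f 0 1+(1/15)*f 1 0+((-1/15)*s)*f 2 4+((1/15)*s)*f 4 2+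
        ((-1/15)*s)*f 1 3+((1/15)*s)*f 3 1)*h3'
    · simp [stdVec]
      linear_combination (1/15)*a3 + ((1/5)*s)*b5 + (-4/15)*c1 + ((2/15)*s)*c4 + ((-8/15)*f 0 2+
        ((-2/15)*s)*f 1 4+(7/15)*f 2 0+((-1/5)*s)*f 2 3+((-2/15)*s)*f 3 2+((-1/5)*s)*f 4 1)*h3'
    · simp [stdVec]
      linear_combination (-2/15)*a4 + ((-1/30)*s)*c3 + (-1/15)*d1 + ((1/30)*s)*e5 +
        ((1/15)*f 0 3+(1/15)*f 3 0)*h3'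
    · simp [stdVec]
      linear_combination (-1/3)*a5 + ((1/15)*s)*b3 + ((2/15)*s)*c2 + ((-2/15)*s)*d5 +
        (2/15)*e1 + ((4/15)*f 0 4+((-2/15)*s)*f 1 2+((-1/5)*s)*f 2 1+((2/15)*s)*f 3 4+
        (-1/3)*f 4 0+((1/5)*s)*f 4 3)*h3'
    · simp [stdVec]
      linear_combination (-1/15)*a2 + (-2/15)*b1 + ((1/15)*s)*b4 + ((1/15)*s)*c5 +
        ((-1/15)*s)*d2 + ((1/15)*f 1 0+(1/15)*f 0 1+((-1/15)*s)*f 2 4+((1/15)*s)*f 4 2+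
        ((-1/15)*s)*f 1 3+((1/15)*s)*f 3 1)*h3'
    · simp [stdVec]
      linear_combination (1/35)*a1 + (-6/35)*b2 + (13/210)*c3 + (17/105)*d4 + (13/210)*e5 +
        ((-13/105)*f 1 1+(-4/35)*f 2 2+(-13/105)*f 3 3+(-4/35)*f 4 4)*h3'
    · simp [stdVec]
    · simp [stdVec]; ring
    · simp [stdVec]
    · simp [stdVec]
      linear_combination (-7/15)*a3 + ((-4/15)*s)*b5 + (1/15)*c1 + ((-2/15)*s)*c4 +
        ((1/15)*s)*d3 + ((-3/5)*f 2 0+((2/15)*s)*f 1 4+(4/5)*f 0 2+((1/5)*s)*f 2 3+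
        ((2/15)*s)*f 3 2+((1/5)*s)*f 4 1)*h3'
    · simp [stdVec]
      linear_combination ((1/15)*s)*a5 + (-2/15)*b3 + (-1/3)*c2 + (1/5)*d5 + ((-2/15)*s)*e1 +
        ((2/3)*f 2 1+(1/15)*f 1 2+(-3/5)*f 3 4)*h3'
    · simp [stdVec]
      linear_combination (9/70)*a1 + ((-1/30)*s)*a4 + (13/210)*b2 + (-6/35)*c3 +
        ((-1/30)*s)*d1 + (13/210)*d4 + (13/210)*e5 + ((11/210)*f 2 2+(23/210)*f 1 1+
        (23/210)*f 3 3+(-17/210)*f 4 4)*h3'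
    · simp [stdVec]
      linear_combination ((1/15)*s)*a3 + (2/15)*b5 + (-1/15)*c4 + (-1/15)*d3 + ((-2/15)*f 2 3+
        (-1/15)*f 1 4+(1/5)*f 3 2)*h3'
    · simp [stdVec]
      linear_combination ((1/30)*s)*a2 + ((1/30)*s)*b1 + (-1/15)*b4 + (-7/30)*c5 + (7/30)*d2 +
        ((2/15)*f 2 4+(7/30)*f 1 3+(-7/30)*f 3 1)*h3'
    · simp [stdVec]
      linear_combination (-1/15)*a4 + ((-1/30)*s)*c3 + (-2/15)*d1 + ((1/30)*s)*e5 +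
        ((1/15)*f 3 0+(1/15)*f 0 3)*h3'
    · simp [stdVec]
      linear_combination (-1/3)*b4 + (-1/3)*d2
    · simp [stdVec]
      linear_combination ((-2/15)*s)*a3 + (-1/3)*b5 + ((2/15)*s)*c1 + (-4/15)*c4 + (-1/15)*d3 +
        ((-2/15)*f 3 2+(2/3)*f 1 4+(4/5)*f 2 3)*h3'
    · simp [stdVec]
      linear_combination (1/35)*a1 + (17/105)*b2 + (13/210)*c3 + (-6/35)*d4 + (13/210)*e5 +
        ((-13/105)*f 3 3+(-13/105)*f 1 1+(-4/35)*f 2 2+(-4/35)*f 4 4)*h3'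
    · simp [stdVec]
      linear_combination ((-2/15)*s)*a5 + (1/15)*b3 + (4/15)*c2 + (-1/3)*d5 + ((2/15)*s)*e1 +
        ((2/3)*f 3 4+(2/15)*f 1 2+(-4/5)*f 2 1)*h3'
    · simp [stdVec]
      linear_combination (-1/15)*a5 + ((-2/15)*s)*b3 + ((-2/15)*s)*c2 + ((1/15)*s)*d5 +
        (-1/3)*e1 + ((1/5)*f 4 0+((2/15)*s)*f 1 2+((1/5)*s)*f 2 1+((-2/15)*s)*f 3 4+
        ((-1/5)*s)*f 4 3)*h3'
    · simp [stdVec]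
      linear_combination ((-4/15)*s)*a3 + (-7/15)*b5 + ((1/5)*s)*c1 + (-1/3)*c4 + (2/15)*d3 +
        ((-1/3)*f 4 1+(16/15)*f 1 4+(1)*f 2 3+(-2/5)*f 3 2)*h3'
    · simp [stdVec]
      linear_combination ((1/30)*s)*a2 + ((1/30)*s)*b1 + (-2/5)*b4 + (-7/30)*c5 + (7/30)*d2 +
        ((-1/3)*f 4 2+(7/30)*f 1 3+(7/15)*f 2 4+(-7/30)*f 3 1)*h3'
    · simp [stdVec]
      linear_combination ((-2/15)*s)*a5 + (-1/5)*b3 + (1/15)*c2 + (-2/15)*d5 + ((1/15)*s)*e1 +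
        ((-1/3)*f 4 3+(4/15)*f 1 2+(-1/5)*f 2 1+(2/5)*f 3 4)*h3'
    · simp [stdVec]
      linear_combination (9/70)*a1 + ((1/30)*s)*a4 + (13/210)*b2 + (13/210)*c3 + ((1/30)*s)*d1 +
        (13/210)*d4 + (-6/35)*e5 + ((11/210)*f 4 4+(23/210)*f 1 1+(-17/210)*f 2 2+
        (23/210)*f 3 3)*h3'
  ext1 v
  have hv : v = ∑ k, v k • stdVec k := by
    ext i; fin_cases i <;> simp [stdVec, Fin.sum_univ_five]
  rw [hv, map_sum, map_sum]
  exact Finset.sum_congr rfl fun k _ => by rw [map_smul, map_smul, aux]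

section Structures

/-- `κ` as a continuous linear map. -/
def kappaL : E3 →L[ℝ] End5 :=
  ∑ i, (EuclideanSpace.proj i : E3 →L[ℝ] ℝ).smulRight (kappaBasis i)

lemma kappaL_apply (y : E3) : kappaL y = kappa y := by
  simp [kappaL, kappa]

lemma exists_skew {B : Matrix (Fin 3) (Fin 3) ℝ} (hB : Bᵀ = -B) : ∃ y : E3, B = skew y := by
  refine ⟨WithLp.toLp 2 ![B 2 1, B 2 0, B 1 0], ?_⟩
  have h (i j) : B j i = - B i j := by
    have := congrFun (congrFun hB i) j
    simpa using this
  have d (i) : B i i = 0 := by have := h i i; linarith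
  ext i j
  fin_cases i <;> fin_cases j <;> simp [skew, d] <;> exact h _ _

lemma skew_transpose (y : E3) : (skew y)ᵀ = -skew y := by
  ext i j
  fin_cases i <;> fin_cases j <;> simp [skew]

lemma trace_skew (y : E3) : (skew y * (skew y)ᵀ).trace = 2 * ‖y‖ ^ 2 := by
  rw [skew_transpose]
  simp [Matrix.trace, skew, Fin.sum_univ_three, EuclideanSpace.norm_sq_eq]
  ring

lemma IsIota.conj_kappa {a : E5 ≃L[ℝ] E5} (ha : IsIota a) (y : E3) :
    ∃ z : E3, ‖z‖ = ‖y‖ ∧ (a : End5) ∘L kappa y ∘L (a.symm : End5) = kappa z := by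
  obtain ⟨h, hh, ha⟩ := ha
  have h1 : h * hᵀ = 1 := by
    have := (Matrix.mem_orthogonalGroup_iff (Fin 3) ℝ).1 (Matrix.mem_specialOrthogonalGroup_iff.1 hh).1
    simpa [Matrix.star_eq_conjTranspose] using this
  have h2 : hᵀ * h = 1 := mul_eq_one_comm.1 h1
  have hi : h⁻¹ = hᵀ := Matrix.inv_eq_right_inv h1
  rw [hi] at ha
  obtain ⟨z, hz⟩ := exists_skew (B := h * skew y * hᵀ) (by
    simp [Matrix.transpose_mul, skew_transpose, Matrix.mul_assoc])
  refine ⟨z, ?_, ?_⟩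
  · have e := trace_skew z
    rw [← hz] at e
    have : (h * skew y * hᵀ) * (h * skew y * hᵀ)ᵀ = h * (skew y * (skew y)ᵀ) * hᵀ := by
      simp only [Matrix.transpose_mul, Matrix.transpose_transpose]
      calc _ = h * skew y * (hᵀ * h) * (skew y)ᵀ * hᵀ := by simp only [Matrix.mul_assoc]
        _ = _ := by rw [h2]; simp only [Matrix.mul_assoc, Matrix.mul_one]
    rw [this, Matrix.trace_mul_comm, ← Matrix.mul_assoc, h2, Matrix.one_mul, trace_skew] at e
    have : ‖z‖ ^ 2 = ‖y‖ ^ 2 := by linarith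
    exact (sq_eq_sq₀ (norm_nonneg _) (norm_nonneg _)).1 this
  · ext1 v
    apply mu_injective
    have hv : mu v = h * mu (a.symm v) * hᵀ := by rw [← ha]; simp
    simp only [ContinuousLinearMap.comp_apply, ContinuousLinearEquiv.coe_coe]
    rw [ha, mu_kappa, mu_kappa, ← hz, hv]
    set m := mu (a.symm v)
    have e1 : h * skew y * hᵀ * (h * m * hᵀ) = h * (skew y * m) * hᵀ := by
      calc _ = h * skew y * (hᵀ * h) * m * hᵀ := by simp only [Matrix.mul_assoc]
        _ = _ := by rw [h2]; simp only [Matrix.mul_assoc, Matrix.mul_one]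
    have e2 : h * m * hᵀ * (h * skew y * hᵀ) = h * (m * skew y) * hᵀ := by
      calc _ = h * m * (hᵀ * h) * skew y * hᵀ := by simp only [Matrix.mul_assoc]
        _ = _ := by rw [h2]; simp only [Matrix.mul_assoc, Matrix.mul_one]
    rw [e1, e2, Matrix.mul_sub, Matrix.sub_mul]

variable (M : Type*) [TopologicalSpace M] [ChartedSpace E5 M] [IsManifold (𝓡 5) ∞ M]

variable {M} in
/-- A frame of `TM`, as a family of isomorphisms `ℝ⁵ → T_x M`, is smooth on `U`. -/
def IsSmoothFrameOn (E : ∀ x : M, E5 ≃L[ℝ] TangentSpace (𝓡 5) x) (U : Set M) : Prop :=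
  ∀ v : E5, ContMDiffOn (𝓡 5) (𝓡 5).tangent ∞ (fun x => (⟨x, E x v⟩ : TangentBundle (𝓡 5) M)) U

/-- An irreducible `SO(3)`-structure on a `5`-manifold: a reduction of the structure group of `TM`
to `ι(SO(3))`, given as the set of adapted frames at each point, which is one orbit of `ι(SO(3))`,
with smooth local sections. -/
structure SO3Structure where
  adapted : ∀ x : M, Set (E5 ≃L[ℝ] TangentSpace (𝓡 5) x)
  mem_adapted_iff : ∀ x : M, ∀ e ∈ adapted x, ∀ e' : E5 ≃L[ℝ] TangentSpace (𝓡 5) x,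
    e' ∈ adapted x ↔ IsIota (e'.trans e.symm)
  exists_smooth_frame : ∀ x₀ : M, ∃ U : Set M, IsOpen U ∧ x₀ ∈ U ∧
    ∃ E : ∀ x : M, E5 ≃L[ℝ] TangentSpace (𝓡 5) x,
      (∀ x ∈ U, E x ∈ adapted x) ∧ IsSmoothFrameOn E U

namespace SO3Structure
variable {M} (S : SO3Structure M)

lemma exists_frame (x₀ : M) : ∃ (U : Set M) (E : ∀ x : M, E5 ≃L[ℝ] TangentSpace (𝓡 5) x),
    IsOpen U ∧ x₀ ∈ U ∧ (∀ x, E x ∈ S.adapted x) ∧ IsSmoothFrameOn E U := by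
  classical
  obtain ⟨U, hU, hx, E, hE, hs⟩ := S.exists_smooth_frame x₀
  have hne (x : M) : ∃ e, e ∈ S.adapted x := by
    obtain ⟨V, -, hxV, E', hE', -⟩ := S.exists_smooth_frame x
    exact ⟨E' x, hE' x hxV⟩
  choose e₀ he₀ using hne
  refine ⟨U, fun x => if x ∈ U then E x else e₀ x, hU, hx, fun x => ?_, fun v => ?_⟩
  · by_cases h : x ∈ U <;> simp [h, hE, he₀]
  · exact (hs v).congr fun x hx => by simp [hx]

/-- A neighbourhood of `x₀` on which the frame `S.frame x₀` is smooth. -/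
def frameDomain (x₀ : M) : Set M := (S.exists_frame x₀).choose

/-- A family of adapted frames that is smooth near `x₀`. -/
def frame (x₀ x : M) : E5 ≃L[ℝ] TangentSpace (𝓡 5) x := (S.exists_frame x₀).choose_spec.choose x

lemma isOpen_frameDomain (x₀ : M) : IsOpen (S.frameDomain x₀) :=
  (S.exists_frame x₀).choose_spec.choose_spec.1

lemma mem_frameDomain (x₀ : M) : x₀ ∈ S.frameDomain x₀ :=
  (S.exists_frame x₀).choose_spec.choose_spec.2.1

lemma frame_mem (x₀ x : M) : S.frame x₀ x ∈ S.adapted x :=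
  (S.exists_frame x₀).choose_spec.choose_spec.2.2.1 x

lemma isSmoothFrameOn_frame (x₀ : M) : IsSmoothFrameOn (S.frame x₀) (S.frameDomain x₀) :=
  (S.exists_frame x₀).choose_spec.choose_spec.2.2.2

/-- An endomorphism of `T_x M` expressed in a frame `e`. -/
def _root_.SO3Twistor.inFrame {x : M} (e : E5 ≃L[ℝ] TangentSpace (𝓡 5) x)
    (σ : TangentSpace (𝓡 5) x →L[ℝ] TangentSpace (𝓡 5) x) : End5 :=
  (e.symm : TangentSpace (𝓡 5) x →L[ℝ] E5) ∘L σ ∘L (e : E5 →L[ℝ] TangentSpace (𝓡 5) x)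

/-- The endomorphism of `T_x M` whose expression in the frame `e` is `A`. -/
def _root_.SO3Twistor.ofFrame {x : M} (e : E5 ≃L[ℝ] TangentSpace (𝓡 5) x) (A : End5) :
    TangentSpace (𝓡 5) x →L[ℝ] TangentSpace (𝓡 5) x :=
  (e : E5 →L[ℝ] TangentSpace (𝓡 5) x) ∘L A ∘L (e.symm : TangentSpace (𝓡 5) x →L[ℝ] E5)

/-- The fibre `{σ ∈ Λ²₃ T_x M : |σ|² = 5}` of the twistor space, `2`-vectors being treated as
endomorphisms of `T_x M` by means of the metric. -/
def twistorFiber (x : M) : Type _ :=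
  {σ : TangentSpace (𝓡 5) x →L[ℝ] TangentSpace (𝓡 5) x //
    ∃ e ∈ S.adapted x, inFrame e σ ∈ lambda23 ∧ ip (inFrame e σ) (inFrame e σ) = 5}

instance (x : M) : TopologicalSpace (S.twistorFiber x) := instTopologicalSpaceSubtype

/-- The unit sphere of `ℝ³`. -/
abbrev S2 := Metric.sphere (0 : E3) 1

lemma mem_twistor (x : M) {e} (he : e ∈ S.adapted x) (σ : S.twistorFiber x) :
    ∃ y : S2, inFrame e σ.1 = kappa y := by
  obtain ⟨σ, e', he', h1, h2⟩ := σ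
  obtain ⟨y, hy⟩ := eq_kappa_of_mem h1
  rw [hy, ip_kappa] at h2
  obtain ⟨z, hz, hz'⟩ := ((S.mem_adapted_iff x e he e').1 he').conj_kappa y
  have hn : ‖y‖ = 1 := by
    have : ‖y‖ ^ 2 = 1 := by rw [← real_inner_self_eq_norm_sq]; linarith
    nlinarith [norm_nonneg y]
  refine ⟨⟨z, by simp [hz, hn]⟩, ?_⟩
  rw [← hz', ← hy]
  ext v
  simp [inFrame]

lemma ofFrame_mem (x : M) {e} (he : e ∈ S.adapted x) (y : S2) :
    ∃ e' ∈ S.adapted x, inFrame e' (ofFrame e (kappa y)) ∈ lambda23 ∧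
      ip (inFrame e' (ofFrame e (kappa y))) (inFrame e' (ofFrame e (kappa y))) = 5 := by
  have : inFrame e (ofFrame e (kappa y)) = kappa y := by
    ext v; simp [inFrame, ofFrame]
  refine ⟨e, he, ?_⟩
  rw [this]
  refine ⟨kappa_mem _, ?_⟩
  rw [ip_kappa, real_inner_self_eq_norm_sq]
  simp

end SO3Structure

end Structures

section Coordinates

variable {M : Type*} [TopologicalSpace M] [ChartedSpace E5 M] [IsManifold (𝓡 5) ∞ M]
namespace SO3Structure
variable (S : SO3Structure M)

lemma sum_coord (v : E5) : ∑ k, v k • stdVec k = v := by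
  ext i; fin_cases i <;> simp [stdVec, Fin.sum_univ_five]

/-- The frame read in a trivialization of the tangent bundle. -/
def frameInTriv (i x₀ x : M) : End5 :=
  ∑ k, (EuclideanSpace.proj k : E5 →L[ℝ] ℝ).smulRight
    (trivializationAt E5 (TangentSpace (𝓡 5)) x₀ ⟨x, S.frame i x (stdVec k)⟩).2

lemma frameInTriv_contMDiffAt {i x₀ : M} (h : x₀ ∈ S.frameDomain i) :
    ContMDiffAt (𝓡 5) 𝓘(ℝ, End5) ∞ (S.frameInTriv i x₀) x₀ := by
  unfold frameInTriv
  refine ContMDiffAt.sum fun k _ => ?_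
  have h1 : ContMDiffAt (𝓡 5) 𝓘(ℝ, E5) ∞ (fun x =>
      (trivializationAt E5 (TangentSpace (𝓡 5)) x₀ ⟨x, S.frame i x (stdVec k)⟩).2) x₀ :=
    (contMDiffAt_section x₀).1
      ((S.isSmoothFrameOn_frame i (stdVec k)).contMDiffAt ((S.isOpen_frameDomain i).mem_nhds h))
  have h2 : ContDiff ℝ ∞ (fun w : E5 => (EuclideanSpace.proj k : E5 →L[ℝ] ℝ).smulRight w) :=
    (ContinuousLinearMap.smulRightL ℝ E5 E5 (EuclideanSpace.proj k)).contDiff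
  exact h2.contMDiff.contMDiffAt.comp x₀ h1

lemma frameInTriv_apply (i : M) {x₀ x : M}
    (hx : x ∈ (trivializationAt E5 (TangentSpace (𝓡 5)) x₀).baseSet) :
    S.frameInTriv i x₀ x = ((S.frame i x).trans
      ((trivializationAt E5 (TangentSpace (𝓡 5)) x₀).continuousLinearEquivAt ℝ x hx) : End5) := by
  ext1 v
  have e1 : (((S.frame i x).trans ((trivializationAt E5 (TangentSpace (𝓡 5)) x₀).continuousLinearEquivAt ℝ x hx) : E5 ≃L[ℝ] E5) : End5) v
    = ∑ k, v k • (((S.frame i x).trans ((trivializationAt E5 (TangentSpace (𝓡 5)) x₀).continuousLinearEquivAt ℝ x hx) : E5 ≃L[ℝ] E5) : End5) (stdVec k) := by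
    conv_lhs => rw [← sum_coord v, map_sum]
    simp only [map_smul]
  rw [e1]
  simp [frameInTriv]

/-- The transition between two adapted frames. -/
def transition (i j x : M) : E5 ≃L[ℝ] E5 := (S.frame j x).trans (S.frame i x).symm

lemma transition_contMDiffOn (i j : M) :
    ContMDiffOn (𝓡 5) 𝓘(ℝ, End5) ∞ (fun x => (S.transition i j x : End5))
      (S.frameDomain i ∩ S.frameDomain j) := by
  intro x₀ hx₀
  refine ContMDiffAt.contMDiffWithinAt ?_
  have hb := (trivializationAt E5 (TangentSpace (𝓡 5)) x₀).open_baseSet.mem_nhds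
    (FiberBundle.mem_baseSet_trivializationAt' x₀)
  have h1 : ContMDiffAt (𝓡 5) 𝓘(ℝ, End5) ∞
      (fun x => (S.frameInTriv i x₀ x).inverse) x₀ := by
    have : ContDiffAt ℝ ∞ ContinuousLinearMap.inverse (S.frameInTriv i x₀ x₀) := by
      rw [S.frameInTriv_apply i (FiberBundle.mem_baseSet_trivializationAt' x₀)]
      exact contDiffAt_map_inverse _
    exact this.contMDiffAt.comp x₀ (S.frameInTriv_contMDiffAt hx₀.1)
  refine (h1.clm_comp (S.frameInTriv_contMDiffAt hx₀.2)).congr_of_eventuallyEq ?_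
  filter_upwards [hb] with x hx
  rw [S.frameInTriv_apply i hx, S.frameInTriv_apply j hx, ContinuousLinearMap.inverse_equiv]
  ext v
  simp [transition, Bundle.Trivialization.symm_apply_apply_mk _ hx]

/-- Change of the coordinates of a point of the twistor space under a change of adapted frame. -/
def coordChange (i j x : M) (y : E3) : E3 :=
  kappaCoord ((S.transition i j x : End5) ∘L kappa y ∘L (S.transition j i x : End5))

/-- `kappaCoord` as a continuous linear map. -/
def kappaCoordL : End5 →L[ℝ] E3 :=
  LinearMap.toContinuousLinearMap
    { toFun := kappaCoord
      map_add' := fun A B => by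
        ext i; simp [kappaCoord, ip, inner_add_left, Finset.sum_add_distrib]; ring
      map_smul' := fun c A => by
        ext i; simp [kappaCoord, ip, inner_smul_left, ← Finset.mul_sum]; ring }

lemma coordChange_contMDiffOn (i j : M) :
    ContMDiffOn ((𝓡 5).prod 𝓘(ℝ, E3)) 𝓘(ℝ, E3) ∞ (fun p : M × E3 => S.coordChange i j p.1 p.2)
      ((S.frameDomain i ∩ S.frameDomain j) ×ˢ Set.univ) := by
  have h1 : ContMDiffOn ((𝓡 5).prod 𝓘(ℝ, E3)) 𝓘(ℝ, End5) ∞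
      (fun p : M × E3 => (S.transition i j p.1 : End5))
      ((S.frameDomain i ∩ S.frameDomain j) ×ˢ Set.univ) :=
    (S.transition_contMDiffOn i j).comp contMDiffOn_fst fun p hp => hp.1
  have h2 : ContMDiffOn ((𝓡 5).prod 𝓘(ℝ, E3)) 𝓘(ℝ, End5) ∞
      (fun p : M × E3 => (S.transition j i p.1 : End5))
      ((S.frameDomain i ∩ S.frameDomain j) ×ˢ Set.univ) :=
    (S.transition_contMDiffOn j i).comp contMDiffOn_fst fun p hp => hp.1.symm
  have h3 : ContMDiffOn ((𝓡 5).prod 𝓘(ℝ, E3)) 𝓘(ℝ, End5) ∞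
      (fun p : M × E3 => kappaL p.2) ((S.frameDomain i ∩ S.frameDomain j) ×ˢ Set.univ) :=
    kappaL.contDiff.contMDiff.comp_contMDiffOn contMDiffOn_snd
  have h4 := kappaCoordL.contDiff.contMDiff.comp_contMDiffOn (h1.clm_comp (h3.clm_comp h2))
  refine h4.congr fun p _ => ?_
  simp [coordChange, kappaCoordL, kappaL_apply]

lemma fiberCoord_mem {x : M} (i : M) (σ : S.twistorFiber x) :
    kappaCoord (inFrame (S.frame i x) σ.1) ∈ Metric.sphere (0 : E3) 1 := by
  obtain ⟨y, hy⟩ := S.mem_twistor x (S.frame_mem i x) σ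
  rw [hy, kappaCoord_kappa]
  exact y.2

/-- The coordinates `(y₁, y₂, y₃)`, a point of the unit sphere, of a point of the twistor fibre. -/
def fiberCoord (i x : M) (σ : S.twistorFiber x) : S2 :=
  ⟨kappaCoord (inFrame (S.frame i x) σ.1), S.fiberCoord_mem i σ⟩

/-- The point `y₁ κ₁ + y₂ κ₂ + y₃ κ₃` of the twistor fibre. -/
def fiberPoint (i x : M) (y : S2) : S.twistorFiber x :=
  ⟨ofFrame (S.frame i x) (kappa y), S.ofFrame_mem x (S.frame_mem i x) y⟩

lemma fiberCoord_fiberPoint (i j x : M) (y : S2) :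
    (S.fiberCoord i x (S.fiberPoint j x y) : E3) = S.coordChange i j x y := by
  simp only [fiberCoord, fiberPoint, coordChange]
  congr 1

lemma fiberCoord_fiberPoint_self (i x : M) (y : S2) :
    S.fiberCoord i x (S.fiberPoint i x y) = y := by
  apply Subtype.ext
  rw [fiberCoord_fiberPoint, coordChange]
  have : (S.transition i i x : End5) ∘L kappa y ∘L (S.transition i i x : End5) = kappa y := by
    ext v; simp [transition]
  rw [this, kappaCoord_kappa]

lemma fiberPoint_fiberCoord (i x : M) (σ : S.twistorFiber x) :
    S.fiberPoint i x (S.fiberCoord i x σ) = σ := by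
  obtain ⟨y, hy⟩ := S.mem_twistor x (S.frame_mem i x) σ
  apply Subtype.ext
  simp only [fiberCoord, fiberPoint, hy, kappaCoord_kappa]
  rw [← hy]
  ext v; simp [inFrame, ofFrame]

end SO3Structure

end Coordinates

section Manifold

variable {M : Type*} [TopologicalSpace M] [ChartedSpace E5 M] [IsManifold (𝓡 5) ∞ M]
namespace SO3Structure
variable (S : SO3Structure M)

/-- The local trivialization `σ ↦ (x, (y₁, y₂, y₃))` of the twistor space given by an adapted frame. -/
def pretriv (i : M) : Pretrivialization S2 (TotalSpace.proj : TotalSpace S2 S.twistorFiber → M) where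
  toFun p := (p.1, S.fiberCoord i p.1 p.2)
  invFun q := ⟨q.1, S.fiberPoint i q.1 q.2⟩
  source := TotalSpace.proj ⁻¹' S.frameDomain i
  target := S.frameDomain i ×ˢ Set.univ
  map_source' p hp := ⟨hp, trivial⟩
  map_target' q hq := hq.1
  left_inv' p _ := by
    obtain ⟨x, σ⟩ := p
    simp [fiberPoint_fiberCoord]
  right_inv' q _ := by simp [fiberCoord_fiberPoint_self]
  open_target := (S.isOpen_frameDomain i).prod isOpen_univ
  baseSet := S.frameDomain i
  open_baseSet := S.isOpen_frameDomain i
  source_eq := rfl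
  target_eq := rfl
  proj_toFun _ _ := rfl

lemma isInducing_fiberCoord (i x : M) : Topology.IsInducing (S.fiberCoord i x) := by
  have c1 : Continuous (S.fiberCoord i x) := by
    refine Continuous.subtype_mk ?_ _
    refine kappaCoordL.continuous.comp (?_ : Continuous fun σ : S.twistorFiber x => inFrame (S.frame i x) σ.1)
    unfold inFrame
    exact (ContinuousLinearMap.postcomp E5 ((S.frame i x).symm : TangentSpace (𝓡 5) x →L[ℝ] E5)).continuous.comp
      ((ContinuousLinearMap.precomp (TangentSpace (𝓡 5) x)
        (S.frame i x : E5 →L[ℝ] TangentSpace (𝓡 5) x)).continuous.comp continuous_subtype_val)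
  have c2 : Continuous (S.fiberPoint i x) := by
    refine Continuous.subtype_mk (f := fun y : S2 => ofFrame (S.frame i x) (kappa y)) ?_ _
    unfold ofFrame
    simp only [← kappaL_apply]
    exact (ContinuousLinearMap.postcomp (TangentSpace (𝓡 5) x)
        (S.frame i x : E5 →L[ℝ] TangentSpace (𝓡 5) x)).continuous.comp
      ((ContinuousLinearMap.precomp E5
        ((S.frame i x).symm : TangentSpace (𝓡 5) x →L[ℝ] E5)).continuous.comp
          (kappaL.continuous.comp continuous_subtype_val))
  exact (Homeomorph.mk ⟨S.fiberCoord i x, S.fiberPoint i x, S.fiberPoint_fiberCoord i x,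
    S.fiberCoord_fiberPoint_self i x⟩ c1 c2).isInducing

/-- The twistor space is a sphere bundle with respect to these trivializations. -/
def prebundle : FiberPrebundle S2 S.twistorFiber where
  pretrivializationAtlas := Set.range S.pretriv
  pretrivializationAt := S.pretriv
  mem_base_pretrivializationAt x := S.mem_frameDomain x
  pretrivialization_mem_atlas x := ⟨x, rfl⟩
  continuous_trivChange := by
    rintro _ ⟨i, rfl⟩ _ ⟨j, rfl⟩
    have : ContinuousOn (fun q : M × S2 => ((q.1, S.fiberCoord i q.1 (S.fiberPoint j q.1 q.2)) : M × S2))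
        ((S.frameDomain i ∩ S.frameDomain j) ×ˢ Set.univ) := by
      refine continuousOn_fst.prodMk (Topology.IsInducing.subtypeVal.continuousOn_iff.2 ?_)
      have h := (S.coordChange_contMDiffOn i j).continuousOn.comp
        (f := fun q : M × S2 => (q.1, (q.2 : E3)))
        (s := (S.frameDomain i ∩ S.frameDomain j) ×ˢ Set.univ) (by fun_prop) (fun q hq => ⟨hq.1, trivial⟩)
      exact h.congr fun q _ => S.fiberCoord_fiberPoint i j q.1 q.2
    exact this.mono fun q hq => ⟨⟨hq.2, hq.1.1⟩, trivial⟩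
  totalSpaceMk_isInducing x := by
    have : (S.pretriv x ∘ TotalSpace.mk x : S.twistorFiber x → M × S2) =
        Prod.mk x ∘ S.fiberCoord x x := rfl
    rw [this]
    exact (isInducing_prodMkRight x).comp (S.isInducing_fiberCoord x x)

/-- The twistor space of `M`. -/
abbrev Twistor : Type _ := TotalSpace S2 S.twistorFiber

instance : TopologicalSpace S.Twistor := S.prebundle.totalSpaceTopology
instance : FiberBundle S2 S.twistorFiber := S.prebundle.toFiberBundle



instance : ChartedSpace (ModelProd E5 (EuclideanSpace ℝ (Fin 2))) S.Twistor :=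
  ChartedSpace.comp _ (M × S2) _

lemma contMDiffOn_sphere {H E N : Type*} [NormedAddCommGroup E] [NormedSpace ℝ E] [TopologicalSpace H]
    {I : ModelWithCorners ℝ E H} [TopologicalSpace N] [ChartedSpace H N] {f : N → S2} {s : Set N}
    (hf : ContMDiffOn I 𝓘(ℝ, E3) ∞ (fun x => (f x : E3)) s) : ContMDiffOn I (𝓡 2) ∞ f s := by
  intro x hx
  have := Fact.mk (@finrank_euclideanSpace_fin ℝ _ (2 + 1))
  rw [contMDiffWithinAt_iff_target]
  refine ⟨Topology.IsInducing.subtypeVal.continuousWithinAt_iff.2 (hf x hx).continuousWithinAt, ?_⟩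
  set v := f x
  let U : _ ≃ₗᵢ[ℝ] _ :=
    (OrthonormalBasis.fromOrthogonalSpanSingleton (𝕜 := ℝ) (E := EuclideanSpace ℝ (Fin (2 + 1)))
        2 (ne_zero_of_mem_unit_sphere (-v))).repr
  have H₀ : ContDiffOn ℝ ∞ (U ∘ stereoToFun ((-v : S2) : E3)) {x | innerSL ℝ ((-v : S2) : E3) x ≠ (1 : ℝ)} :=
    U.contDiff.comp_contDiffOn contDiffOn_stereoToFun
  have ho : IsOpen {x : E3 | innerSL ℝ ((-v : S2) : E3) x ≠ (1 : ℝ)} :=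
    isOpen_ne.preimage (innerSL ℝ ((-v : S2) : E3)).continuous
  have hv : (v : E3) ∈ {x : E3 | innerSL ℝ ((-v : S2) : E3) x ≠ (1 : ℝ)} := by
    have : ‖(v : E3)‖ = 1 := by simp
    simp
    norm_num
  have H₁ := (H₀.contDiffAt (ho.mem_nhds hv)).contMDiffAt
  have H₂ := ContMDiffAt.comp_contMDiffWithinAt x (g := U ∘ stereoToFun ((-v : S2) : E3)) (f := fun x => (f x : E3)) H₁ (hf x hx)
  exact H₂

/-- The change of trivializations of the twistor space. -/
def trivChange (i j : M) (q : M × S2) : M × S2 := (q.1, S.fiberCoord i q.1 (S.fiberPoint j q.1 q.2))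

lemma trivChange_contMDiffOn (i j : M) :
    ContMDiffOn ((𝓡 5).prod (𝓡 2)) ((𝓡 5).prod (𝓡 2)) ∞ (S.trivChange i j)
      ((S.frameDomain i ∩ S.frameDomain j) ×ˢ Set.univ) := by
  have := Fact.mk (@finrank_euclideanSpace_fin ℝ _ (2 + 1))
  refine contMDiffOn_fst.prodMk (contMDiffOn_sphere ?_)
  have hc : ContMDiff (𝓡 2) 𝓘(ℝ, E3) ∞ (fun y : S2 => (y : E3)) := contMDiff_coe_sphere
  have h := (S.coordChange_contMDiffOn i j).comp
    (f := fun q : M × S2 => (q.1, (q.2 : E3))) (I := (𝓡 5).prod (𝓡 2))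
    (s := (S.frameDomain i ∩ S.frameDomain j) ×ˢ Set.univ)
    (contMDiffOn_fst.prodMk (hc.comp_contMDiffOn contMDiffOn_snd)) (fun q hq => ⟨hq.1, trivial⟩)
  exact h.congr fun q _ => S.fiberCoord_fiberPoint i j q.1 q.2

/-- The pseudogroup of local diffeomorphisms of `M × S²`. -/
def smoothPregroupoid : Pregroupoid (M × S2) where
  property f u := ContMDiffOn ((𝓡 5).prod (𝓡 2)) ((𝓡 5).prod (𝓡 2)) ∞ f u
  comp hf hg _ _ _ := hg.comp (hf.mono Set.inter_subset_left) Set.inter_subset_right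
  id_mem := contMDiffOn_id
  locality _ h := contMDiffOn_of_locally_contMDiffOn h
  congr _ h hf := hf.congr h

instance : HasGroupoid S.Twistor (smoothPregroupoid (M := M)).groupoid where
  compatible := by
    rintro _ _ ⟨_, ⟨_, ⟨i, rfl⟩, rfl⟩, rfl⟩ ⟨_, ⟨_, ⟨j, rfl⟩, rfl⟩, rfl⟩
    rw [mem_groupoid_of_pregroupoid]
    refine ⟨(S.trivChange_contMDiffOn j i).mono ?_, (S.trivChange_contMDiffOn i j).mono ?_⟩
    · intro q hq
      exact ⟨⟨hq.2, hq.1.1⟩, trivial⟩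
    · intro q hq
      exact ⟨⟨hq.2, hq.1.1⟩, trivial⟩

instance : IsManifold ((𝓡 5).prod (𝓡 2)) ∞ S.Twistor := by
  refine { StructureGroupoid.HasGroupoid.comp (smoothPregroupoid (M := M)).groupoid ?_ with }
  intro e he
  rw [isLocalStructomorphOn_contDiffGroupoid_iff]
  exact he

end SO3Structure

end Manifold

section Model

/-- The components `g(A, e_a ∧ e_b)` of a `2`-vector. -/
def toForm (A : End5) (a b : Fin 5) : ℝ := ⟪A (stdVec a), stdVec b⟫_ℝ

/-- The Hodge star `∗(A ∧ B) ∈ ℝ⁵` of the wedge product of two `2`-vectors. -/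
def starWedge (A B : End5) : E5 := WithLp.toLp 2 fun m =>
  let α : Fin 4 → Fin 4 → ℝ := fun i j => toForm A (m.succAbove i) (m.succAbove j)
  let β : Fin 4 → Fin 4 → ℝ := fun i j => toForm B (m.succAbove i) (m.succAbove j)
  (-1 : ℝ) ^ (m : ℕ) * (α 0 1 * β 2 3 - α 0 2 * β 1 3 + α 0 3 * β 1 2
    + α 1 2 * β 0 3 - α 1 3 * β 0 2 + α 2 3 * β 0 1)

/-- `ξ_σ = ¼ ∗(σ ∧ σ)`. -/
def xi (A : End5) : E5 := (1 / 4 : ℝ) • starWedge A A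

/-- `g(∗_H σ, X ∧ Y)`, where `∗_H` is the Hodge star of `H = ξ_σ^⊥`, oriented so that `ℝ ξ_σ ⊕ H` has
the orientation of `ℝ⁵`: its value is the component of `∗(σ ∧ X ∧ Y)` along `ξ_σ`. -/
def starH (A : End5) (X Y : E5) : ℝ := ⟪starWedge A (wedge X Y), xi A⟫_ℝ

/-- `g(σ_ε, X ∧ Y)` for the self-dual (`ε = 1`) or anti-self-dual (`ε = -1`) component
`σ_ε = ½ (σ + ε ∗_H σ)` of `σ ∈ Λ² H`. -/
def halfDual (ε : ℝ) (A : End5) (X Y : E5) : ℝ := 1 / 2 * (⟪A X, Y⟫_ℝ + ε * starH A X Y)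

/-- `φ_ε^σ`, `ε = ± 1`: `g(φ_ε^σ X, Y) = 2 / (2 + ε) g(σ_ε, X ∧ Y)`. It vanishes on `ξ_σ`. -/
def phi (ε : ℝ) (A : End5) : End5 :=
  ∑ a, ∑ b, (innerSL ℝ (stdVec a)).smulRight
    ((2 / (2 + ε) * halfDual ε A (stdVec a) (stdVec b)) • stdVec b)

/-- The vector product `y × ·` of `Λ²₃` in the coordinates given by the oriented basis `κ₁, κ₂, κ₃`,
in which the fibre of the twistor space is the unit sphere (`κ₁ × κ₂ = κ₃`). -/
def cross (y : E3) : E3 →L[ℝ] E3 :=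
  LinearMap.toContinuousLinearMap
    ((WithLp.linearEquiv 2 ℝ (Fin 3 → ℝ)).symm.toLinearMap ∘ₗ
      crossProduct y.ofLp ∘ₗ (WithLp.linearEquiv 2 ℝ (Fin 3 → ℝ)).toLinearMap)

/-- Radial projection to the unit sphere (with an arbitrary value at `0`). -/
def toSphere (v : E3) : SO3Structure.S2 :=
  @dite _ (v = 0) (Classical.propDecidable _)
    (fun _ => ⟨EuclideanSpace.single 0 1, by simp⟩)
    (fun h => ⟨‖v‖⁻¹ • v, by simp [norm_smul, h]⟩)

end Model

section General

variable {E H N : Type*} [NormedAddCommGroup E] [NormedSpace ℝ E] [TopologicalSpace H]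
  (I : ModelWithCorners ℝ E H) [TopologicalSpace N] [ChartedSpace H N]

/-- The Nijenhuis bracket `[JA, JB] - J[JA, B] - J[A, JB] - [A, B]`. -/
def nijenhuis (J : ∀ p : N, TangentSpace I p → TangentSpace I p)
    (A B : ∀ p : N, TangentSpace I p) (p : N) : TangentSpace I p :=
  VectorField.mlieBracket I (fun q => J q (A q)) (fun q => J q (B q)) p
    - J p (VectorField.mlieBracket I (fun q => J q (A q)) B p)
    - J p (VectorField.mlieBracket I A (fun q => J q (B q)) p)
    - VectorField.mlieBracket I A B p

/-- An almost complex structure is integrable when its Nijenhuis tensor vanishes. -/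
def IsIntegrable [IsManifold I 1 N] (J : ∀ p : N, TangentSpace I p → TangentSpace I p) : Prop :=
  ∀ (U : Set N) (A B : ∀ p : N, TangentSpace I p), IsOpen U →
    ContMDiffOn I I.tangent ∞ (fun p => (⟨p, A p⟩ : TangentBundle I N)) U →
    ContMDiffOn I I.tangent ∞ (fun p => (⟨p, B p⟩ : TangentBundle I N)) U →
    ∀ p ∈ U, nijenhuis I J A B p = 0

/-- The vector field `d/dθ` on the circle. -/
def circleField (z : Circle) : TangentSpace (𝓡 1) z :=
  mfderiv 𝓘(ℝ, ℝ) (𝓡 1) (fun s : ℝ => z * Circle.exp s) 0 (1 : ℝ)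

/-- The one-form `dθ` on the circle. -/
def circleForm (z : Circle) (w : TangentSpace (𝓡 1) z) : ℝ :=
  let w' : ℂ := mfderiv (𝓡 1) 𝓘(ℝ, ℂ) (fun q : Circle => (q : ℂ)) z w
  ((starRingEnd ℂ) (z : ℂ) * w').im

/-- The almost complex structure `J(X, f d/dθ) = (φ X - f ξ, η(X) d/dθ)` on `N × S¹` induced by an
almost contact structure on `N`. -/
def inducedJ (φ : ∀ p : N, TangentSpace I p →ₗ[ℝ] TangentSpace I p) (ξ : ∀ p : N, TangentSpace I p)
    (η : ∀ p : N, TangentSpace I p →ₗ[ℝ] ℝ) (q : N × Circle)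
    (w : TangentSpace (I.prod (𝓡 1)) q) : TangentSpace (I.prod (𝓡 1)) q :=
  let X : TangentSpace I q.1 := w.1
  let f : ℝ := circleForm q.2 w.2
  ((φ q.1 X - f • ξ q.1, η q.1 X • circleField q.2) : TangentSpace I q.1 × TangentSpace (𝓡 1) q.2)

/-- Normality of an almost contact structure. -/
def IsNormal [IsManifold I 1 N] (φ : ∀ p : N, TangentSpace I p →ₗ[ℝ] TangentSpace I p) (ξ : ∀ p : N, TangentSpace I p)
    (η : ∀ p : N, TangentSpace I p →ₗ[ℝ] ℝ) : Prop :=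
  IsIntegrable (I.prod (𝓡 1)) (inducedJ I φ ξ η)

end General

section TwistorTensors

variable {M : Type*} [TopologicalSpace M] [ChartedSpace E5 M] [IsManifold (𝓡 5) ∞ M]
namespace SO3Structure
variable (S : SO3Structure M)

/-- Covariant derivatives on `TM`. -/
abbrev Cov (M : Type*) [TopologicalSpace M] [ChartedSpace E5 M] [IsManifold (𝓡 5) ∞ M] :=
  CovariantDerivative (𝓡 5) E5 (fun x : M => TangentSpace (𝓡 5) x)

/-- `D` is an `SO(3)`-connection: its connection forms with respect to the adapted frames take values
in the Lie algebra of `ι(SO(3))`. -/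
def IsSO3Connection (D : Cov M) : Prop :=
  ∀ (U : Set M) (E : ∀ x : M, E5 ≃L[ℝ] TangentSpace (𝓡 5) x), IsOpen U →
    (∀ x ∈ U, E x ∈ S.adapted x) → IsSmoothFrameOn E U →
      ∀ x ∈ U, ∀ X : TangentSpace (𝓡 5) x,
        IsIotaLie fun v => (E x).symm (D (fun z => E z v) x X)

/-- The Riemannian metric of `M` for which the adapted frames are orthonormal. -/
def metric (x : M) (X Y : TangentSpace (𝓡 5) x) : ℝ :=
  ⟪(S.frame x x).symm X, (S.frame x x).symm Y⟫_ℝ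

/-- The connection form at `x` with respect to the adapted frame `E = S.frame x`, `X ↦ E⁻¹ ∘ ∇_X E`. -/
def connectionForm (D : Cov M) (x : M) : TangentSpace (𝓡 5) x →L[ℝ] End5 :=
  ∑ k, (ContinuousLinearMap.smulRightL ℝ E5 E5 (EuclideanSpace.proj k)) ∘L
    ((S.frame x x).symm : TangentSpace (𝓡 5) x →L[ℝ] E5) ∘L D (fun z => S.frame x z (stdVec k)) x

/-- The endomorphism of `ℝ⁵` that expresses `σ` in an adapted frame at `π(σ)`. -/
def point (σ : S.Twistor) : End5 := inFrame (S.frame σ.proj σ.proj) σ.2.1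

/-- `X ↦ ∑ y_i ∇_X κ_i` at `π(σ)` in the coordinates of `Λ²₃`, where `σ = ∑ y_i κ_i`. -/
def inducedForm (D : Cov M) (σ : S.Twistor) : TangentSpace (𝓡 5) σ.proj →L[ℝ] E3 :=
  kappaCoordL ∘L ((ContinuousLinearMap.compL ℝ E5 E5 E5).flip (S.point σ)
    - ContinuousLinearMap.compL ℝ E5 E5 E5 (S.point σ)) ∘L S.connectionForm D σ.proj

/-- The functions `(y₁, y₂, y₃)` on the twistor space defined by the adapted frame `S.frame i`. -/
def fiberCoordE (i : M) (τ : S.Twistor) : E3 := kappaCoord (inFrame (S.frame i τ.proj) τ.2.1)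

/-- The map `(x, v) ↦ ∑ y_i κ_i(x)`, `y = v / |v|`, a local parametrization for `|v| = 1`. -/
def pointOf (i : M) (p : M × E3) : S.Twistor := ⟨p.1, S.fiberPoint i p.1 (toSphere p.2)⟩

/-- The tangent space of the twistor space at `σ`. -/
abbrev TTwistor (σ : S.Twistor) := TangentSpace ((𝓡 5).prod (𝓡 2)) σ

/-- The differential of the projection `π`. -/
def dproj (σ : S.Twistor) : S.TTwistor σ →L[ℝ] TangentSpace (𝓡 5) σ.proj :=
  mfderiv ((𝓡 5).prod (𝓡 2)) (𝓡 5) (TotalSpace.proj : S.Twistor → M) σ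

/-- The vertical part of a tangent vector, as an element of `Λ²₃` orthogonal to `σ` in coordinates:
`dy_i + ∑ y_j g(∇_{dπ} κ_j, κ_i) / 5`. -/
def vertPart (D : Cov M) (σ : S.Twistor) : S.TTwistor σ →L[ℝ] E3 :=
  let dy : S.TTwistor σ →L[ℝ] E3 :=
    mfderiv ((𝓡 5).prod (𝓡 2)) 𝓘(ℝ, E3) (S.fiberCoordE σ.proj) σ
  dy + S.inducedForm D σ ∘L S.dproj σ

/-- The tangent vector with components `X` and `dy = u` in the local coordinates `(x, y)`. -/
def lift (σ : S.Twistor) : TangentSpace (𝓡 5) σ.proj × E3 →L[ℝ] S.TTwistor σ :=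
  mfderiv ((𝓡 5).prod 𝓘(ℝ, E3)) ((𝓡 5).prod (𝓡 2)) (S.pointOf σ.proj)
    (σ.proj, S.fiberCoordE σ.proj σ)

/-- The horizontal lift `X^h_σ`, with `dy_i = - ∑ y_j g(∇_X κ_j, κ_i) / 5`. -/
def hLift (D : Cov M) (σ : S.Twistor) : TangentSpace (𝓡 5) σ.proj →L[ℝ] S.TTwistor σ :=
  S.lift σ ∘L (ContinuousLinearMap.id ℝ (TangentSpace (𝓡 5) σ.proj)).prod (-S.inducedForm D σ)

/-- The vertical tangent vector `V ∈ Λ²₃`, `V ⟂ σ`, at `σ`. -/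
def vLift (σ : S.Twistor) : E3 →L[ℝ] S.TTwistor σ :=
  S.lift σ ∘L ContinuousLinearMap.inr ℝ (TangentSpace (𝓡 5) σ.proj) E3

/-- `Φ^{(n)}_ε`, `n = 1, 2`, `ε = ± 1`: `X^h ↦ (φ_ε^σ X)^h` and `V ↦ (-1)^n σ × V` for vertical `V`. -/
def Phi (D : Cov M) (n : ℕ) (ε : ℝ) (σ : S.Twistor) : S.TTwistor σ →ₗ[ℝ] S.TTwistor σ :=
  (S.hLift D σ ∘L ofFrame (S.frame σ.proj σ.proj) (phi ε (S.point σ)) ∘L S.dproj σ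
    + (-1 : ℝ) ^ n • S.vLift σ ∘L cross (S.fiberCoordE σ.proj σ) ∘L S.vertPart D σ :
      S.TTwistor σ →L[ℝ] S.TTwistor σ)

/-- `χ_σ = (ξ_σ)^h`. -/
def chi (D : Cov M) (σ : S.Twistor) : S.TTwistor σ :=
  S.hLift D σ (S.frame σ.proj σ.proj (xi (S.point σ)))

/-- `h_t(X^h + V, Y^h + W) = g(X, Y) + t g(V, W)`. -/
def hMetric (D : Cov M) (t : ℝ) (σ : S.Twistor) :
    S.TTwistor σ →ₗ[ℝ] S.TTwistor σ →ₗ[ℝ] ℝ :=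
  LinearMap.mk₂ ℝ (fun w w' => S.metric σ.proj (S.dproj σ w) (S.dproj σ w')
      + t * ip (kappa (S.vertPart D σ w)) (kappa (S.vertPart D σ w')))
    (fun a b c => by simp only [metric, ip_kappa, map_add, inner_add_left]; ring)
    (fun a b c => by simp only [metric, ip_kappa, map_smul, real_inner_smul_left, smul_eq_mul]; ring)
    (fun a b c => by simp only [metric, ip_kappa, map_add, inner_add_right]; ring)
    (fun a b c => by simp only [metric, ip_kappa, map_smul, real_inner_smul_right, smul_eq_mul]; ring)

/-- The one-form `η = h_t(·, χ)`. -/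
def eta (D : Cov M) (t : ℝ) (σ : S.Twistor) : S.TTwistor σ →ₗ[ℝ] ℝ :=
  (S.hMetric D t σ).flip (S.chi D σ)

end SO3Structure

end TwistorTensors

end
end SO3Twistor

/-!
The Nijenhuis tensor of the almost complex structure `J` on `𝕋 × S¹` is evaluated on a vertical field
`A` and a field `B` whose projection to `TM` has constant components `e_k` in a local adapted frame. Only its projection to `TM` is needed, and this does not involve the curvature or the
torsion of the connection: the bracket of a vertical field `A` with a field whose projection to `TM`
has the components `b` in a frame `E` of `TM` projects to the field with components `A(b)`
(`dproj_mlieBracket_coordField`). This is seen by applying the fields to a chart of `M`, as a function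
on `𝕋 × S¹` (`mvfderiv_mlieBracket`).

Since `JA` is again vertical, being `(-1)ⁿ σ × A`, and `JB` projects to `φ(e_k)`, the brackets `[A, B]`
and `[JA, B]` are vertical, while `[JA, JB]` and `[A, JB]` project to `(D_{JA} φ) e_k` and
`(D_A φ) e_k`. Moreover `J` acts on projections by `φ`, modulo `ξ`. Hence normality implies
`(D_{JA} φ - φ ∘ D_A φ) e_k ∈ ℝ ξ` for all `k` (`obstruction_eq_zero`), where `D` is the derivative in
the direction of the fibre, the unit sphere of `Λ²₃`.

On that sphere `φ` is an explicit cubic polynomial in `σ`, viewed as an endomorphism (`phi_kappa`).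
At `σ = κ₃`, where `ξ` is a multiple of `e₁`, and for `A = κ₁`, a computation with matrices shows that
the condition fails in all three cases (`obstruction_ne_zero`).

The tensors are defined with a frame that depends on the point of `M`. Their equivariance under
`ι(SO(3))` and the transformation of the connection form (`transition_mul_connForm`) give their
expressions in one smooth local frame (`Phi_eq_liftAt`, `eta_apply`), from which the smoothness of
`JA` and `JB` follows.
-/

namespace SO3Twistor
noncomputable section

/-! ### The algebra of `κ`, `ξ` and the Hodge dual -/

lemma real_inner_stdVec (v : E5) (k : Fin 5) : ⟪v, stdVec k⟫_ℝ = v k := by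
  simp [stdVec, EuclideanSpace.inner_single_right]

lemma cross_apply (y v : E3) : cross y v = WithLp.toLp 2
    ![y 1 * v 2 - y 2 * v 1, y 2 * v 0 - y 0 * v 2, y 0 * v 1 - y 1 * v 0] := by
  ext i; fin_cases i <;> simp [cross, crossProduct]

/-- The map `-κ` is a homomorphism of Lie algebras, from the vector product to the commutator. -/
lemma kappa_commutator (y v : E3) :
    kappa y ∘L kappa v - kappa v ∘L kappa y = -kappa (cross y v) := by
  have h3 : √3 ^ 2 = 3 := by norm_num
  ext x i
  simp only [sub_apply, ContinuousLinearMap.comp_apply,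
    neg_apply, kappa_apply, cross_apply]
  fin_cases i <;> simp <;> ring_nf <;> simp only [h3] <;> ring

lemma toForm_eq (A : End5) (a b : Fin 5) : toForm A a b = A (stdVec a) b :=
  real_inner_stdVec _ _

lemma xi_kappa (y : E3) : xi (kappa y) = WithLp.toLp 2
    ![(y 0 ^ 2 + y 1 ^ 2) / 2 - y 2 ^ 2, -(√3 * y 0 * y 1),
      √3 * y 0 * y 2, √3 * (y 1 ^ 2 - y 0 ^ 2) / 2, -(√3 * y 1 * y 2)] := by
  have h3 : √3 ^ 2 = 3 := by norm_num
  ext i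
  simp only [xi, starWedge, toForm_eq, kappa_apply]
  fin_cases i <;> simp [stdVec, Fin.succAbove] <;> ring_nf

/-- `ξ` as a polynomial in the matrix `skew y`, which shows its equivariance under `SO(3)`. -/
lemma mu_xi_kappa (y : E3) : mu (xi (kappa y)) =
    √3 • (skew y * skew y + (2 / 3 * (y 0 ^ 2 + y 1 ^ 2 + y 2 ^ 2)) • 1) := by
  have h3 : √3 ^ 2 = 3 := by norm_num
  have h3' : √3 ≠ 0 := by positivity
  rw [xi_kappa]
  ext i j
  fin_cases i <;> fin_cases j <;> simp [mu, skew] <;> field_simp <;> ring_nf <;>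
    (try simp only [h3]) <;> ring_nf

set_option maxHeartbeats 1000000 in
/-- The Hodge dual of `κ(y)` in the hyperplane `ξ^⊥` is a polynomial in the endomorphism `κ(y)`. -/
lemma starH_kappa (y : E3) (a b : Fin 5) : starH (kappa y) (stdVec a) (stdVec b) =
    5 / 2 * (y 0 ^ 2 + y 1 ^ 2 + y 2 ^ 2) * kappa y (stdVec a) b +
      1 / 2 * kappa y (kappa y (kappa y (stdVec a))) b := by
  have h3 : √3 ^ 2 = 3 := by norm_num
  have h4 : √3 ^ 3 = 3 * √3 := by rw [pow_succ, h3]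
  rw [starH, xi_kappa]
  simp only [PiLp.inner_apply, Fin.sum_univ_five, starWedge, toForm_eq, kappa_apply]
  fin_cases a <;> fin_cases b <;> simp [stdVec, Fin.succAbove, wedge, EuclideanSpace.inner_single_left]
  all_goals ring_nf
  all_goals (try simp only [h3, h4])
  all_goals (try ring_nf)

/-! ### The endomorphism `φ`, its equivariance and its derivative -/

lemma end5_mul_apply (A B : End5) (x : E5) : (A * B) x = A (B x) := rfl

/-! Compatibility of scalars with the product of `End5`, for `smul_mul_assoc` and `mul_smul_comm`. -/

instance : IsScalarTower ℝ End5 End5 := ⟨fun _ _ _ => rfl⟩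

instance : SMulCommClass ℝ End5 End5 :=
  ⟨fun a A B => by ext1 x; exact (map_smul A a (B x)).symm⟩

lemma clm_apply_eq_sum (A : End5) (x : E5) : A x = ∑ a, x a • A (stdVec a) := by
  conv_lhs => rw [← SO3Structure.sum_coord x, map_sum]
  simp only [map_smul]

lemma sq_sum_of_norm_eq_one {y : E3} (hy : ‖y‖ = 1) : y 0 ^ 2 + y 1 ^ 2 + y 2 ^ 2 = 1 := by
  have := EuclideanSpace.norm_sq_eq y
  rw [hy, Fin.sum_univ_three] at this
  simpa using this.symm

lemma phi_stdVec (ε : ℝ) (A : End5) (a b : Fin 5) :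
    phi ε A (stdVec a) b = 2 / (2 + ε) * halfDual ε A (stdVec a) (stdVec b) := by
  have h (c : Fin 5) : ⟪stdVec c, stdVec a⟫_ℝ = if c = a then 1 else 0 := by
    rw [real_inner_stdVec, stdVec, PiLp.single_apply]; simp [eq_comm]
  simp [phi, h, Finset.sum_ite_irrel]
  simp [stdVec]

/-- On the unit sphere `φ` is a cubic polynomial in the endomorphism `κ(y)`; in this form it is visibly
equivariant, and it can be differentiated. -/
lemma phi_kappa (ε : ℝ) {y : E3} (hy : ‖y‖ = 1) : phi ε (kappa y) =
    ((1 + 5 / 2 * ε) / (2 + ε)) • kappa y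
      + (ε / 2 / (2 + ε)) • (kappa y * kappa y * kappa y) := by
  have h : ∀ a, phi ε (kappa y) (stdVec a) = (((1 + 5 / 2 * ε) / (2 + ε)) • kappa y
      + (ε / 2 / (2 + ε)) • (kappa y * kappa y * kappa y)) (stdVec a) := by
    intro a
    ext b
    rw [phi_stdVec, halfDual, starH_kappa, real_inner_stdVec, sq_sum_of_norm_eq_one hy]
    simp only [add_apply, smul_apply, PiLp.add_apply, PiLp.smul_apply,
      end5_mul_apply, smul_eq_mul]
    ring
  ext1 x
  rw [clm_apply_eq_sum, clm_apply_eq_sum _ x]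
  simp only [h]

/-- The equivariance of `φ`. -/
lemma phi_kappa_semiconj (ε : ℝ) {y z : E3} (hy : ‖y‖ = 1) (hz : ‖z‖ = 1) {a : End5}
    (h : kappa z * a = a * kappa y) : phi ε (kappa z) * a = a * phi ε (kappa y) := by
  have h3 : kappa z * kappa z * kappa z * a = a * (kappa y * kappa y * kappa y) := by
    rw [mul_assoc, h, mul_assoc, ← mul_assoc _ a, h, ← mul_assoc, ← mul_assoc, h]
    simp only [mul_assoc]
  rw [phi_kappa ε hy, phi_kappa ε hz, add_mul, mul_add, smul_mul_assoc, smul_mul_assoc,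
    mul_smul_comm, mul_smul_comm, h, h3]

lemma trace_mu_mul_mu (u v : E5) : (mu u * mu v).trace = 2 * ⟪u, v⟫_ℝ := by
  have h3 : √3 ^ 2 = 3 := by norm_num
  have h3' : √3 ≠ 0 := by positivity
  simp only [Matrix.trace, mu, PiLp.inner_apply, Fin.sum_univ_five, Fin.sum_univ_three]
  simp
  field_simp
  ring_nf
  rw [h3]; ring

lemma IsIota.exists_rotation {a : E5 ≃L[ℝ] E5} (ha : IsIota a) :
    ∃ h : Matrix (Fin 3) (Fin 3) ℝ, hᵀ * h = 1 ∧ ∀ v, mu (a v) = h * mu v * hᵀ := by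
  obtain ⟨h, hh, ha⟩ := ha
  have h1 : h * hᵀ = 1 := by
    have := (Matrix.mem_orthogonalGroup_iff (Fin 3) ℝ).1
      (Matrix.mem_specialOrthogonalGroup_iff.1 hh).1
    simpa [Matrix.star_eq_conjTranspose] using this
  rw [Matrix.inv_eq_right_inv h1] at ha
  exact ⟨h, mul_eq_one_comm.1 h1, ha⟩

lemma conj_mul_conj {h : Matrix (Fin 3) (Fin 3) ℝ} (hh : hᵀ * h = 1)
    (A B : Matrix (Fin 3) (Fin 3) ℝ) : h * A * hᵀ * (h * B * hᵀ) = h * (A * B) * hᵀ := by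
  calc _ = h * A * (hᵀ * h) * B * hᵀ := by simp only [Matrix.mul_assoc]
    _ = _ := by rw [hh]; simp only [Matrix.mul_assoc, Matrix.mul_one]

lemma IsIota.inner_map {a : E5 ≃L[ℝ] E5} (ha : IsIota a) (u v : E5) :
    ⟪a u, a v⟫_ℝ = ⟪u, v⟫_ℝ := by
  obtain ⟨h, hh, ha⟩ := ha.exists_rotation
  have := trace_mu_mul_mu (a u) (a v)
  rw [ha, ha, conj_mul_conj hh, Matrix.trace_mul_comm, ← Matrix.mul_assoc, hh, Matrix.one_mul,
    trace_mu_mul_mu] at this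
  linarith

lemma kappa_injective : Function.Injective kappa := fun y z h => by
  rw [← kappaCoord_kappa y, h, kappaCoord_kappa]

/-- The equivariance of `ξ`. -/
lemma IsIota.map_xi {a : E5 ≃L[ℝ] E5} (ha : IsIota a) {y z : E3} (hy : ‖y‖ = 1) (hz : ‖z‖ = 1)
    (h : kappa z * (a : End5) = a * kappa y) : a (xi (kappa y)) = xi (kappa z) := by
  obtain ⟨r, hr, ha⟩ := ha.exists_rotation
  obtain ⟨w, hw⟩ := exists_skew (B := r * skew y * rᵀ) (by
    simp [Matrix.transpose_mul, skew_transpose, Matrix.mul_assoc])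
  have hwz : w = z := by
    apply kappa_injective
    have h1 : kappa w * (a : End5) = a * kappa y := by
      ext1 v
      apply mu_injective
      simp only [end5_mul_apply, ContinuousLinearEquiv.coe_coe]
      rw [ha, mu_kappa, mu_kappa, ← hw, ha, conj_mul_conj hr, conj_mul_conj hr, Matrix.mul_sub,
        Matrix.sub_mul]
    ext1 v
    have := congrArg (fun A : End5 => A (a.symm v)) (h1.trans h.symm)
    simpa [end5_mul_apply] using this
  have hr' : r * rᵀ = 1 := mul_eq_one_comm.1 hr
  apply mu_injective
  rw [ha, mu_xi_kappa, mu_xi_kappa, ← hwz, ← hw, conj_mul_conj hr, hwz, sq_sum_of_norm_eq_one hy,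
    sq_sum_of_norm_eq_one hz]
  simp [Matrix.mul_add, Matrix.add_mul, hr']

/-- The differential of `y ↦ phi ε (kappa y)` on the unit sphere. -/
def dPhi (ε : ℝ) (y w : E3) : End5 :=
  ((1 + 5 / 2 * ε) / (2 + ε)) • kappa w + (ε / 2 / (2 + ε)) •
    ((kappa w * kappa y + kappa y * kappa w) * kappa y + kappa y * kappa y * kappa w)

lemma hasDerivAt_phi_kappa (ε : ℝ) {c : ℝ → E3} {w : E3} (hc : ∀ s, ‖c s‖ = 1)
    (hw : HasDerivAt c w 0) : HasDerivAt (fun s => phi ε (kappa (c s))) (dPhi ε (c 0) w) 0 := by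
  have h1 : HasDerivAt (fun s => kappa (c s)) (kappa w) 0 := by
    simp only [← kappaL_apply]
    exact kappaL.hasFDerivAt.comp_hasDerivAt 0 hw
  have h2 := (h1.const_smul ((1 + 5 / 2 * ε) / (2 + ε))).add
    (((h1.mul h1).mul h1).const_smul (ε / 2 / (2 + ε)))
  refine h2.congr_of_eventuallyEq (.of_forall fun s => ?_)
  simp only [phi_kappa ε (hc s)]; rfl

/-- `D_{JV} φ - φ ∘ D_V φ` at `σ = κ₃`, `V = κ₁`, `JV = (-1)ⁿ κ₃ × κ₁ = (-1)ⁿ κ₂`. -/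
def obstruction (ε δ : ℝ) : End5 :=
  dPhi ε (EuclideanSpace.single 2 1) (δ • EuclideanSpace.single 1 1)
    - phi ε (kappa (EuclideanSpace.single 2 1)) *
      dPhi ε (EuclideanSpace.single 2 1) (EuclideanSpace.single 0 1)

/-- The component along `e₃` is tested because it is orthogonal to `ξ`; the basis vector `e₁` shows the
claim in the first two cases and `e₄` in the third. -/
lemma obstruction_ne_zero {ε δ : ℝ} (h : (ε = -1 ∧ δ = -1) ∨ (ε = 1 ∧ δ = 1) ∨ (ε = -1 ∧ δ = 1)) :
    ∃ k, obstruction ε δ (stdVec k) 2 ≠ 0 := by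
  have h3 : √3 ≠ 0 := by positivity
  have e : ‖(EuclideanSpace.single 2 1 : E3)‖ = 1 := by simp
  rcases h with ⟨rfl, rfl⟩ | ⟨rfl, rfl⟩ | ⟨rfl, rfl⟩
  · refine ⟨0, ?_⟩
    rw [obstruction, phi_kappa _ e, dPhi, dPhi]
    simp [kappa_apply, stdVec]
    ring_nf
    simp
  · refine ⟨0, ?_⟩
    rw [obstruction, phi_kappa _ e, dPhi, dPhi]
    simp [kappa_apply, stdVec]
    ring_nf
    simp
  · refine ⟨3, ?_⟩
    rw [obstruction, phi_kappa _ e, dPhi, dPhi]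
    simp [kappa_apply, stdVec]
    norm_num

/-- The relation between the brackets of a vertical and a basic horizontal field that follows from
integrability, up to multiples of `ξ`; at `κ₃` the vector `ξ` is a multiple of `e₁`. -/
lemma obstruction_apply_eq_zero {ε δ c₂ c₃ : ℝ} {y u v : E3} {x : E5}
    (hy : y = EuclideanSpace.single 2 1) (hu : u = δ • EuclideanSpace.single 1 1)
    (hv : v = EuclideanSpace.single 0 1)
    (h : dPhi ε y u x - (phi ε (kappa y) 0 - c₂ • xi (kappa y)) -
      (phi ε (kappa y) (dPhi ε y v x) - c₃ • xi (kappa y)) - 0 = 0) :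
    obstruction ε δ x 2 = 0 := by
  have e1 : obstruction ε δ = dPhi ε y u - phi ε (kappa y) * dPhi ε y v := by
    rw [obstruction, hy, hu, hv]
  have e2 : obstruction ε δ x = dPhi ε y u x - phi ε (kappa y) (dPhi ε y v x) := by
    rw [e1]; rfl
  have hx : xi (kappa y) 2 = 0 := by rw [hy]; simp [xi_kappa]
  rw [map_zero] at h
  have h3 : obstruction ε δ x = - (c₂ + c₃) • xi (kappa y) := by
    rw [e2, ← sub_eq_zero, ← h]
    module
  rw [h3]
  simp [hx]

/-! ### Functions and Lie brackets on manifolds -/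

section LieBracket

/-- `df([X, Y]) = X(df(Y)) - Y(df(X))` in a vector space, by the symmetry of the second derivative. -/
lemma fderiv_lieBracket {E F : Type*} [NormedAddCommGroup E] [NormedSpace ℝ E]
    [NormedAddCommGroup F] [NormedSpace ℝ F] {f : E → F} {X Y : E → E} {u : E}
    (hf : ContDiffAt ℝ 2 f u) (hX : DifferentiableAt ℝ X u) (hY : DifferentiableAt ℝ Y u) :
    fderiv ℝ f u (VectorField.lieBracket ℝ X Y u) =
      fderiv ℝ (fun v => fderiv ℝ f v (Y v)) u (X u)
        - fderiv ℝ (fun v => fderiv ℝ f v (X v)) u (Y u) := by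
  have h2 : DifferentiableAt ℝ (fderiv ℝ f) u :=
    (hf.fderiv_right (m := 1) (by norm_num)).differentiableAt one_ne_zero
  have hs : IsSymmSndFDerivAt ℝ f u := hf.isSymmSndFDerivAt (by simp)
  have e (Z : E → E) (hZ : DifferentiableAt ℝ Z u) (w : E) :
      fderiv ℝ (fun v => fderiv ℝ f v (Z v)) u w
        = fderiv ℝ f u (fderiv ℝ Z u w) + fderiv ℝ (fderiv ℝ f) u w (Z u) := by
    rw [fderiv_clm_apply h2 hZ]; simp
  rw [e Y hY, e X hX, VectorField.lieBracket, map_sub, hs.eq (X u) (Y u)]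
  abel

variable {E H N F : Type*} [NormedAddCommGroup E] [NormedSpace ℝ E] [CompleteSpace E]
  [TopologicalSpace H]
  {I : ModelWithCorners ℝ E H} [I.Boundaryless] [TopologicalSpace N] [ChartedSpace H N]
  [IsManifold I ∞ N] [NormedAddCommGroup F] [NormedSpace ℝ F]

/-- `df([X, Y]) = X(df(Y)) - Y(df(X))` for vector-valued functions `f` on a manifold. -/
lemma mvfderiv_mlieBracket {f : N → F} {X Y : ∀ p : N, TangentSpace I p} {p : N}
    (hf : ContMDiffAt I 𝓘(ℝ, F) ∞ f p)
    (hX : MDifferentiableAt I I.tangent (fun q => (⟨q, X q⟩ : TangentBundle I N)) p)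
    (hY : MDifferentiableAt I I.tangent (fun q => (⟨q, Y q⟩ : TangentBundle I N)) p) :
    mvfderiv I f p (VectorField.mlieBracket I X Y p) =
      mvfderiv I (fun q => mvfderiv I f q (Y q)) p (X p)
        - mvfderiv I (fun q => mvfderiv I f q (X q)) p (Y p) := by
  have h2 : IsManifold I 2 N :=
    IsManifold.of_le (n := ∞) (WithTop.coe_le_coe.2 (le_top : (2 : ℕ∞) ≤ ⊤))
  have h1 : IsManifold I 1 N := IsManifold.of_le (n := ∞) (by exact_mod_cast (le_top (a := (1 : ℕ∞))))
  set φ := extChartAt I p with hφ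
  set X' := VectorField.mpullbackWithin 𝓘(ℝ, E) I φ.symm X (Set.range I) with hX'
  set Y' := VectorField.mpullbackWithin 𝓘(ℝ, E) I φ.symm Y (Set.range I) with hY'
  set f' := f ∘ φ.symm with hf'
  have dX : DifferentiableAt ℝ X' (φ p) := by
    have := MDifferentiableWithinAt.differentiableWithinAt_mpullbackWithin_vectorField
      hX.mdifferentiableWithinAt (s := Set.univ)
    rw [Set.preimage_univ, Set.univ_inter] at this
    exact this.differentiableAt (by rw [I.range_eq_univ]; exact Filter.univ_mem)
  have dY : DifferentiableAt ℝ Y' (φ p) := by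
    have := MDifferentiableWithinAt.differentiableWithinAt_mpullbackWithin_vectorField
      hY.mdifferentiableWithinAt (s := Set.univ)
    rw [Set.preimage_univ, Set.univ_inter] at this
    exact this.differentiableAt (by rw [I.range_eq_univ]; exact Filter.univ_mem)
  have hc : ContDiffAt ℝ 2 f' (φ p) := by
    have h := (contMDiffOn_extChartAt_symm (I := I) (n := ∞) p).contMDiffAt
      (extChartAt_target_mem_nhds (I := I) p)
    have := ContMDiffAt.comp_of_eq (I' := I) hf h (extChartAt_to_inv p)
    exact this.contDiffAt.of_le (WithTop.coe_le_coe.2 (le_top : (2 : ℕ∞) ≤ ⊤))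
  have hd : ∀ᶠ q in 𝓝 p, DifferentiableAt ℝ f' (φ q) := by
    have : ∀ᶠ u in 𝓝 (φ p), DifferentiableAt ℝ f' u := by
      filter_upwards [hc.eventually (by simp)] with u hu using hu.differentiableAt two_ne_zero
    exact (continuousAt_extChartAt (I := I) p).eventually this
  have hs := extChartAt_source_mem_nhds (I := I) p
  have dφ : ∀ q ∈ φ.source, MDifferentiableAt I 𝓘(ℝ, E) φ q := fun q hq =>
    mdifferentiableAt_extChartAt (by simpa [hφ] using hq)
  -- `df` and the fields are transported to the chart `φ`, where `f` becomes `f'`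
  have key1 : ∀ᶠ q in 𝓝 p, mvfderiv I f q = fderiv ℝ f' (φ q) ∘L mfderiv I 𝓘(ℝ, E) φ q := by
    filter_upwards [hd, hs] with q hq hqs
    have e : f =ᶠ[𝓝 q] f' ∘ φ := by
      filter_upwards [(isOpen_extChartAt_source (I := I) p).mem_nhds hqs] with r hr
      exact congrArg f ((extChartAt I p).left_inv hr).symm
    have : mfderiv I 𝓘(ℝ, F) f q = mfderiv I 𝓘(ℝ, F) (f' ∘ φ) q := e.mfderiv_eq
    rw [mfderiv_comp q hq.mdifferentiableAt (dφ q hqs), mfderiv_eq_fderiv] at this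
    exact this
  have key2 (Z : ∀ p : N, TangentSpace I p) : ∀ᶠ q in 𝓝 p, mfderiv I 𝓘(ℝ, E) φ q (Z q) =
      VectorField.mpullbackWithin 𝓘(ℝ, E) I φ.symm Z (Set.range I) (φ q) := by
    have := VectorField.eventuallyEq_mpullback_mpullbackWithin_extChartAt (I := I) (s := Set.univ) (x := p) Z
    rw [nhdsWithin_univ] at this
    filter_upwards [this, hs] with q hq hqs
    have hi : (mfderiv I 𝓘(ℝ, E) φ q).IsInvertible := isInvertible_mfderiv_extChartAt hqs
    rw [hq, VectorField.mpullback_apply]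
    exact hi.self_apply_inverse _
  have key3 (Z W : ∀ p : N, TangentSpace I p)
      (hZ : DifferentiableAt ℝ (VectorField.mpullbackWithin 𝓘(ℝ, E) I φ.symm Z (Set.range I)) (φ p)) :
      mvfderiv I (fun q => mvfderiv I f q (Z q)) p (W p) = fderiv ℝ (fun u => fderiv ℝ f' u
        (VectorField.mpullbackWithin 𝓘(ℝ, E) I φ.symm Z (Set.range I) u)) (φ p)
        (VectorField.mpullbackWithin 𝓘(ℝ, E) I φ.symm W (Set.range I) (φ p)) := by
    set g : E → F := fun u => fderiv ℝ f' u
        (VectorField.mpullbackWithin 𝓘(ℝ, E) I φ.symm Z (Set.range I) u) with hg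
    have e : (fun q => mvfderiv I f q (Z q)) =ᶠ[𝓝 p] g ∘ φ := by
      filter_upwards [key1, key2 Z] with q h1 h2
      rw [h1]
      exact congrArg (fderiv ℝ f' (φ q)) h2
    have dg : DifferentiableAt ℝ g (φ p) :=
      ((hc.fderiv_right (m := 1) (by norm_num)).differentiableAt one_ne_zero).clm_apply hZ
    have : mfderiv I 𝓘(ℝ, F) (fun q => mvfderiv I f q (Z q)) p = mfderiv I 𝓘(ℝ, F) (g ∘ φ) p :=
      e.mfderiv_eq
    rw [mfderiv_comp p dg.mdifferentiableAt (dφ p (mem_extChartAt_source p)), mfderiv_eq_fderiv] at this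
    have h := (key2 W).self_of_nhds
    rw [← h]
    exact congrArg (fun A => A (W p)) this
  rw [key3 Y X dY, key3 X Y dX, ← fderiv_lieBracket hc dX dY, key1.self_of_nhds]
  have hi : (mfderiv I 𝓘(ℝ, E) φ p).IsInvertible :=
    isInvertible_mfderiv_extChartAt (mem_extChartAt_source p)
  let B : E := VectorField.lieBracketWithin ℝ (fun u => (X' u : E)) (fun u => (Y' u : E))
    (Set.univ ∩ Set.range I) (φ p)
  have hB : B = VectorField.lieBracket ℝ (fun u => (X' u : E)) (fun u => (Y' u : E)) (φ p) := by
    simp only [B, Set.univ_inter, I.range_eq_univ]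
    exact congrFun VectorField.lieBracketWithin_univ _
  exact congrArg (fderiv ℝ f' (φ p)) ((hi.self_apply_inverse B).trans hB)
end LieBracket

/-! ### Local coordinates of the twistor space -/

section TwistorCharts

variable {M : Type*} [TopologicalSpace M] [ChartedSpace E5 M] [IsManifold (𝓡 5) ∞ M]
namespace SO3Structure
variable (S : SO3Structure M)

lemma toSphere_coe (y : S2) : toSphere (y : E3) = y := by
  have h : (y : E3) ≠ 0 := fun h => by simpa [h] using y.2
  apply Subtype.ext
  simp [toSphere, h]

lemma coe_toSphere {v : E3} (hv : v ≠ 0) : (toSphere v : E3) = ‖v‖⁻¹ • v := by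
  simp [toSphere, hv]

lemma contMDiffOn_toSphere : ContMDiffOn 𝓘(ℝ, E3) (𝓡 2) ∞ toSphere {0}ᶜ := by
  refine contMDiffOn_sphere ?_
  have h : ContDiffOn ℝ ∞ (fun v : E3 => ‖v‖⁻¹ • v) {0}ᶜ := by
    intro v hv
    exact (((contDiffAt_norm ℝ hv).inv (norm_ne_zero_iff.2 hv)).smul contDiffAt_id).contDiffWithinAt
  exact h.contMDiffOn.congr fun v hv => coe_toSphere hv

/-- Smoothness at `σ` of a map from the twistor space can be tested in the local trivialization of the
twistor space at `σ`. -/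
lemma contMDiffAt_iff_comp_chart {E H N : Type*} [NormedAddCommGroup E] [NormedSpace ℝ E]
    [TopologicalSpace H] {I : ModelWithCorners ℝ E H} [TopologicalSpace N] [ChartedSpace H N]
    {f : S.Twistor → N} {σ : S.Twistor} :
    ContMDiffAt ((𝓡 5).prod (𝓡 2)) I ∞ f σ ↔
      ContMDiffAt ((𝓡 5).prod (𝓡 2)) I ∞ (f ∘ (chartAt (M × S2) σ).symm)
        (chartAt (M × S2) σ σ) := by
  have hσ := mem_chart_source (M × S2) σ
  rw [contMDiffAt_iff, contMDiffAt_iff]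
  have e : ((f ∘ (chartAt (M × S2) σ).symm) (chartAt (M × S2) σ σ)) = f σ := by
    simp [(chartAt (M × S2) σ).left_inv hσ]
  refine and_congr ?_ ?_
  · constructor
    · intro h
      refine ContinuousAt.comp (by rwa [(chartAt (M × S2) σ).left_inv hσ])
        ((chartAt (M × S2) σ).continuousAt_symm (mem_chart_target (M × S2) σ))
    · intro h
      have := h.comp ((chartAt (M × S2) σ).continuousAt hσ)
      refine this.congr ?_
      filter_upwards [(chartAt (M × S2) σ).open_source.mem_nhds hσ] with τ hτ
      simp [(chartAt (M × S2) σ).left_inv hτ]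
  · rw [e]; rfl

/-- Smoothness of a map to the twistor space can be tested in a local trivialization. -/
lemma contMDiffAt_chart_comp_iff {E H N : Type*} [NormedAddCommGroup E] [NormedSpace ℝ E]
    [TopologicalSpace H] {I : ModelWithCorners ℝ E H} [TopologicalSpace N] [ChartedSpace H N]
    {g : N → S.Twistor} {q : N} (h : ContinuousAt g q) :
    ContMDiffAt I ((𝓡 5).prod (𝓡 2)) ∞ g q ↔
      ContMDiffAt I ((𝓡 5).prod (𝓡 2)) ∞ (chartAt (M × S2) (g q) ∘ g) q := by
  rw [contMDiffAt_iff, contMDiffAt_iff]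
  refine and_congr ?_ ?_
  · exact ⟨fun _ => ((chartAt (M × S2) (g q)).continuousAt (mem_chart_source _ _)).comp h,
      fun _ => h⟩
  · rfl

lemma contMDiff_proj : ContMDiff ((𝓡 5).prod (𝓡 2)) (𝓡 5) ∞
    (TotalSpace.proj : S.Twistor → M) := by
  intro σ
  rw [S.contMDiffAt_iff_comp_chart]
  exact contMDiffAt_fst

lemma contMDiffAt_fiberCoordE {i : M} {σ : S.Twistor} (h : σ.proj ∈ S.frameDomain i) :
    ContMDiffAt ((𝓡 5).prod (𝓡 2)) 𝓘(ℝ, E3) ∞ (S.fiberCoordE i) σ := by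
  have := Fact.mk (@finrank_euclideanSpace_fin ℝ _ (2 + 1))
  rw [S.contMDiffAt_iff_comp_chart]
  have hc : ContMDiff (𝓡 2) 𝓘(ℝ, E3) ∞ (fun y : S2 => (y : E3)) := contMDiff_coe_sphere
  have h := (S.coordChange_contMDiffOn i σ.proj).comp
    (f := fun q : M × S2 => (q.1, (q.2 : E3))) (I := (𝓡 5).prod (𝓡 2))
    (s := (S.frameDomain i ∩ S.frameDomain σ.proj) ×ˢ Set.univ)
    (contMDiffOn_fst.prodMk (hc.comp_contMDiffOn contMDiffOn_snd)) (fun q hq => ⟨hq.1, trivial⟩)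
  have h' : ContMDiffOn ((𝓡 5).prod (𝓡 2)) 𝓘(ℝ, E3) ∞
      (S.fiberCoordE i ∘ (chartAt (M × S2) σ).symm)
      ((S.frameDomain i ∩ S.frameDomain σ.proj) ×ˢ Set.univ) :=
    h.congr fun q _ => S.fiberCoord_fiberPoint i σ.proj q.1 q.2
  refine h'.contMDiffAt (IsOpen.mem_nhds ?_ ⟨⟨‹_›, S.mem_frameDomain _⟩, trivial⟩)
  exact ((S.isOpen_frameDomain _).inter (S.isOpen_frameDomain _)).prod isOpen_univ

lemma contMDiffAt_pointOf {i x : M} {v : E3} (h : x ∈ S.frameDomain i) (hv : v ≠ 0) :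
    ContMDiffAt ((𝓡 5).prod 𝓘(ℝ, E3)) ((𝓡 5).prod (𝓡 2)) ∞ (S.pointOf i) (x, v) := by
  have hs : ContMDiffAt ((𝓡 5).prod 𝓘(ℝ, E3)) (𝓡 2) ∞ (fun q : M × E3 => toSphere q.2) (x, v) :=
    (contMDiffOn_toSphere.contMDiffAt (isOpen_compl_singleton.mem_nhds hv)).comp (x, v)
      contMDiffAt_snd
  have hg : ContMDiffAt ((𝓡 5).prod 𝓘(ℝ, E3)) ((𝓡 5).prod (𝓡 2)) ∞
      (fun q : M × E3 => (q.1, toSphere q.2)) (x, v) := contMDiffAt_fst.prodMk hs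
  -- the chart at any point over `i` is the trivialization defined by the frame `S.frame i`
  let σ : S.Twistor := S.pointOf i (i, v)
  have hc : ContinuousAt (S.pointOf i) (x, v) := by
    have h1 : ContinuousAt (chartAt (M × S2) σ).symm (x, toSphere v) :=
      (chartAt (M × S2) σ).continuousAt_symm (⟨h, trivial⟩ : _ ∈ S.frameDomain i ×ˢ Set.univ)
    exact ContinuousAt.comp (f := fun q : M × E3 => (q.1, toSphere q.2)) h1 hg.continuousAt
  rw [S.contMDiffAt_chart_comp_iff hc]
  refine ContMDiffAt.comp (x, v) (g := S.trivChange x i)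
    (f := fun q : M × E3 => (q.1, toSphere q.2)) ?_ hg
  refine (S.trivChange_contMDiffOn x i).contMDiffAt (IsOpen.mem_nhds ?_
    ⟨⟨S.mem_frameDomain x, h⟩, trivial⟩)
  exact ((S.isOpen_frameDomain _).inter (S.isOpen_frameDomain _)).prod isOpen_univ

lemma norm_fiberCoordE (i : M) (σ : S.Twistor) : ‖S.fiberCoordE i σ‖ = 1 := by
  exact mem_sphere_zero_iff_norm.1 (S.fiberCoord_mem i σ.2)

lemma fiberCoordE_ne_zero (i : M) (σ : S.Twistor) : S.fiberCoordE i σ ≠ 0 := by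
  rw [← norm_ne_zero_iff, norm_fiberCoordE]; exact one_ne_zero

lemma fiberCoordE_pointOf (i : M) (q : M × E3) :
    S.fiberCoordE i (S.pointOf i q) = toSphere q.2 :=
  congrArg Subtype.val (S.fiberCoord_fiberPoint_self i q.1 (toSphere q.2))

lemma pointOf_fiberCoordE (i : M) (σ : S.Twistor) :
    S.pointOf i (σ.proj, S.fiberCoordE i σ) = σ := by
  obtain ⟨x, σ⟩ := σ
  have h : S.fiberCoordE i ⟨x, σ⟩ = (S.fiberCoord i x σ : E3) := rfl
  simp only [pointOf, h, toSphere_coe, S.fiberPoint_fiberCoord]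

lemma kappa_fiberCoordE (i : M) (σ : S.Twistor) :
    kappa (S.fiberCoordE i σ) = inFrame (S.frame i σ.proj) σ.2.1 := by
  obtain ⟨y, hy⟩ := S.mem_twistor σ.proj (S.frame_mem i σ.proj) σ.2
  rw [fiberCoordE, hy, kappaCoord_kappa]

lemma point_eq (σ : S.Twistor) : S.point σ = kappa (S.fiberCoordE σ.proj σ) :=
  (S.kappa_fiberCoordE σ.proj σ).symm

lemma differentiableAt_coe_toSphere {y : E3} (hy : y ≠ 0) :
    DifferentiableAt ℝ (fun v => (toSphere v : E3)) y := by
  have he : (fun v => (toSphere v : E3)) =ᶠ[𝓝 y] fun v => ‖v‖⁻¹ • v := by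
    filter_upwards [isOpen_compl_singleton.mem_nhds hy] with v hv using coe_toSphere hv
  exact (((((contDiffAt_norm ℝ hy).differentiableAt (n := 1) one_ne_zero).inv
    (norm_ne_zero_iff.2 hy)).smul differentiableAt_id)).congr_of_eventuallyEq he

/-- The projection to the unit sphere preserves tangent vectors of the sphere. -/
lemma fderiv_coe_toSphere {y u : E3} (hy : ‖y‖ = 1) (hu : ⟪y, u⟫_ℝ = 0) :
    fderiv ℝ (fun v => (toSphere v : E3)) y u = u := by
  have hy0 : y ≠ 0 := by rw [← norm_ne_zero_iff, hy]; exact one_ne_zero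
  have hn : HasFDerivAt (fun v : E3 => ‖v‖) (fderiv ℝ (fun v : E3 => ‖v‖) y) y :=
    ((contDiffAt_norm ℝ hy0).differentiableAt (n := 1) one_ne_zero).hasFDerivAt
  have h0 : fderiv ℝ (fun v : E3 => ‖v‖) y u = 0 := by
    have h1 := hn.mul hn
    have h2 : HasFDerivAt (fun v : E3 => ‖v‖ * ‖v‖) _ y :=
      (hasStrictFDerivAt_norm_sq y).hasFDerivAt.congr_of_eventuallyEq
        (.of_forall fun v => (sq ‖v‖).symm)
    have := congrArg (fun A => A u) (h1.unique h2)
    simp [hy, hu] at this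
    linarith
  have he : (fun v => (toSphere v : E3)) =ᶠ[𝓝 y] fun v => ‖v‖⁻¹ • v := by
    filter_upwards [isOpen_compl_singleton.mem_nhds hy0] with v hv using coe_toSphere hv
  have h3 := (((hasDerivAt_inv (norm_ne_zero_iff.2 hy0)).comp_hasFDerivAt y hn).smul
    (hasFDerivAt_id y)).congr_of_eventuallyEq he
  rw [h3.fderiv]
  simp [hy, h0]

/-- The tangent vector at `σ` with components `X` and `u` in the coordinates `(x, y)` defined by the
adapted frame `S.frame i`. -/
def liftAt (i : M) (σ : S.Twistor) : TangentSpace (𝓡 5) σ.proj × E3 →L[ℝ] S.TTwistor σ :=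
  mfderiv ((𝓡 5).prod 𝓘(ℝ, E3)) ((𝓡 5).prod (𝓡 2)) (S.pointOf i) (σ.proj, S.fiberCoordE i σ)

/-- The differential of the coordinates `y` defined by the adapted frame `S.frame i`. -/
def dFiber (i : M) (σ : S.Twistor) : S.TTwistor σ →L[ℝ] E3 :=
  mfderiv ((𝓡 5).prod (𝓡 2)) 𝓘(ℝ, E3) (S.fiberCoordE i) σ

variable {S}

lemma mdifferentiableAt_pointOf {i : M} {σ : S.Twistor} (h : σ.proj ∈ S.frameDomain i) :
    MDifferentiableAt ((𝓡 5).prod 𝓘(ℝ, E3)) ((𝓡 5).prod (𝓡 2)) (S.pointOf i)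
      (σ.proj, S.fiberCoordE i σ) :=
  (S.contMDiffAt_pointOf h (S.fiberCoordE_ne_zero i σ)).mdifferentiableAt (by simp)

lemma mdifferentiableAt_fiberCoordE {i : M} {σ : S.Twistor} (h : σ.proj ∈ S.frameDomain i) :
    MDifferentiableAt ((𝓡 5).prod (𝓡 2)) 𝓘(ℝ, E3) (S.fiberCoordE i) σ :=
  (S.contMDiffAt_fiberCoordE h).mdifferentiableAt (by simp)

lemma mdifferentiableAt_proj (σ : S.Twistor) :
    MDifferentiableAt ((𝓡 5).prod (𝓡 2)) (𝓡 5) (TotalSpace.proj : S.Twistor → M) σ :=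
  (S.contMDiff_proj σ).mdifferentiableAt (by simp)

lemma dproj_liftAt {i : M} {σ : S.Twistor} (h : σ.proj ∈ S.frameDomain i)
    (w : TangentSpace (𝓡 5) σ.proj × E3) : S.dproj σ (S.liftAt i σ w) = w.1 := by
  have h1 := mfderiv_comp_apply_of_eq (σ.proj, S.fiberCoordE i σ) (mdifferentiableAt_proj σ)
    (mdifferentiableAt_pointOf h) (S.pointOf_fiberCoordE i σ) w
  have h2 : (TotalSpace.proj : S.Twistor → M) ∘ S.pointOf i = Prod.fst := rfl
  rw [h2, mfderiv_fst] at h1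
  rw [S.pointOf_fiberCoordE i σ] at h1
  exact h1.symm

/-- The components `u` of a tangent vector are determined by it if `u` is tangent to the sphere. -/
lemma dFiber_liftAt {i : M} {σ : S.Twistor} (h : σ.proj ∈ S.frameDomain i)
    {w : TangentSpace (𝓡 5) σ.proj × E3} (hw : ⟪S.fiberCoordE i σ, w.2⟫_ℝ = 0) :
    S.dFiber i σ (S.liftAt i σ w) = w.2 := by
  have h1 := mfderiv_comp_apply_of_eq (σ.proj, S.fiberCoordE i σ) (mdifferentiableAt_fiberCoordE h)
    (mdifferentiableAt_pointOf h) (S.pointOf_fiberCoordE i σ) w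
  have h2 : S.fiberCoordE i ∘ S.pointOf i = (fun v => (toSphere v : E3)) ∘ Prod.snd :=
    funext fun q => S.fiberCoordE_pointOf i q
  have h3 : DifferentiableAt ℝ (fun v => (toSphere v : E3)) (S.fiberCoordE i σ) :=
    differentiableAt_coe_toSphere (S.fiberCoordE_ne_zero i σ)
  rw [h2, mfderiv_comp (σ.proj, S.fiberCoordE i σ) h3.mdifferentiableAt mdifferentiableAt_snd,
    mfderiv_snd, mfderiv_eq_fderiv] at h1
  rw [S.pointOf_fiberCoordE i σ] at h1
  exact h1.symm.trans (fderiv_coe_toSphere (S.norm_fiberCoordE i σ) hw)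

/-- A tangent vector is recovered from its components. -/
lemma liftAt_dproj_dFiber {i : M} {σ : S.Twistor} (h : σ.proj ∈ S.frameDomain i)
    (w : S.TTwistor σ) : S.liftAt i σ (S.dproj σ w, S.dFiber i σ w) = w := by
  have h1 := mfderiv_comp_apply σ (mdifferentiableAt_pointOf h)
    ((mdifferentiableAt_proj σ).prodMk (mdifferentiableAt_fiberCoordE h)) w
  have h2 : S.pointOf i ∘ (fun τ : S.Twistor => (τ.proj, S.fiberCoordE i τ)) = id :=
    funext fun τ => S.pointOf_fiberCoordE i τ
  rw [h2, mfderiv_id, mfderiv_prodMk (mdifferentiableAt_proj σ) (mdifferentiableAt_fiberCoordE h)] at h1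
  exact h1.symm

end SO3Structure
end TwistorCharts

/-! ### Change of adapted frame -/

section Gauge

lemma mvfderiv_end5_mul {E H N : Type*} [NormedAddCommGroup E] [NormedSpace ℝ E]
    [TopologicalSpace H] {I : ModelWithCorners ℝ E H} [TopologicalSpace N] [ChartedSpace H N]
    {p q : N → End5} {z : N} (hp : MDifferentiableAt I 𝓘(ℝ, End5) p z)
    (hq : MDifferentiableAt I 𝓘(ℝ, End5) q z) (w : TangentSpace I z) :
    mvfderiv I (fun r => p r * q r) z w =
      p z * mvfderiv I q z w + mvfderiv I p z w * q z := by
  have h := (hp.hasMFDerivAt.mul' hq.hasMFDerivAt).mfderiv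
  exact congrArg (fun A => A w) h

lemma _root_.CovariantDerivative.map_sum {E H N F ι : Type*} [NormedAddCommGroup E]
    [NormedSpace ℝ E] [TopologicalSpace H] {I : ModelWithCorners ℝ E H} [TopologicalSpace N]
    [ChartedSpace H N] [NormedAddCommGroup F] [NormedSpace ℝ F] {V : N → Type*}
    [TopologicalSpace (TotalSpace F V)] [∀ x, AddCommGroup (V x)] [∀ x, Module ℝ (V x)]
    [∀ x, TopologicalSpace (V x)] [∀ x, IsTopologicalAddGroup (V x)]
    [∀ x, ContinuousSMul ℝ (V x)] [FiberBundle F V] [VectorBundle ℝ F V]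
    (D : CovariantDerivative I F V) {f : ι → ∀ x, V x} {s : Finset ι} {x : N}
    (hf : ∀ j ∈ s, MDifferentiableAt I (I.prod 𝓘(ℝ, F))
      (fun z => (⟨z, f j z⟩ : TotalSpace F V)) x) :
    D (fun z => ∑ j ∈ s, f j z) x = ∑ j ∈ s, D (f j) x := by
  classical
  induction s using Finset.induction_on with
  | empty => simp only [Finset.sum_empty]; exact congrFun D.zero x
  | insert a s ha ih =>
    have hs : ∀ j ∈ s, _ := fun j hj => hf j (Finset.mem_insert_of_mem hj)
    have h := D.isCovariantDerivativeOn.add (s := Set.univ) (x := x)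
      (hf a (Finset.mem_insert_self a s)) (MDifferentiableAt.sum_section hs)
    rw [Finset.sum_insert ha, ← ih hs, ← h]
    congr 1
    funext z
    simp [Finset.sum_insert ha]

variable {M : Type*} [TopologicalSpace M] [ChartedSpace E5 M] [IsManifold (𝓡 5) ∞ M]
namespace SO3Structure
variable (S : SO3Structure M)

/-- The connection form with respect to the adapted frame `S.frame i`. -/
def connForm (D : Cov M) (i x : M) : TangentSpace (𝓡 5) x →L[ℝ] End5 :=
  ∑ k, (ContinuousLinearMap.smulRightL ℝ E5 E5 (EuclideanSpace.proj k)) ∘L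
    ((S.frame i x).symm : TangentSpace (𝓡 5) x →L[ℝ] E5) ∘L D (fun z => S.frame i z (stdVec k)) x

lemma connForm_apply (D : Cov M) (i x : M) (X : TangentSpace (𝓡 5) x) (v : E5) :
    S.connForm D i x X v =
      ∑ k, v k • (S.frame i x).symm (D (fun z => S.frame i z (stdVec k)) x X) := by
  simp [connForm]

lemma connForm_apply_stdVec (D : Cov M) (i x : M) (X : TangentSpace (𝓡 5) x) (k : Fin 5) :
    S.connForm D i x X (stdVec k) =
      (S.frame i x).symm (D (fun z => S.frame i z (stdVec k)) x X) := by
  rw [connForm_apply]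
  simp [stdVec, ite_smul]

variable {S}

lemma mdifferentiableAt_frame {i x : M} (h : x ∈ S.frameDomain i) (v : E5) :
    MDifferentiableAt (𝓡 5) (𝓡 5).tangent
      (fun z => (⟨z, S.frame i z v⟩ : TangentBundle (𝓡 5) M)) x :=
  ((S.isSmoothFrameOn_frame i v).contMDiffAt
    ((S.isOpen_frameDomain i).mem_nhds h)).mdifferentiableAt (by simp)

lemma mdifferentiableAt_transition {i j x : M} (hi : x ∈ S.frameDomain i)
    (hj : x ∈ S.frameDomain j) :
    MDifferentiableAt (𝓡 5) 𝓘(ℝ, End5) (fun z => (S.transition i j z : End5)) x :=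
  ((S.transition_contMDiffOn i j).contMDiffAt (((S.isOpen_frameDomain i).inter
    (S.isOpen_frameDomain j)).mem_nhds ⟨hi, hj⟩)).mdifferentiableAt (by simp)

lemma frame_transition (i j x : M) (v : E5) :
    S.frame i x (S.transition i j x v) = S.frame j x v := by
  simp [transition]

lemma isIota_transition (i j x : M) : IsIota (S.transition i j x) :=
  (S.mem_adapted_iff x _ (S.frame_mem i x) _).1 (S.frame_mem j x)

/-- The change of the connection form under a change of the adapted frame: `a ω' = da + ω a`. -/
lemma transition_mul_connForm (D : Cov M) {i j x : M} (hi : x ∈ S.frameDomain i)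
    (hj : x ∈ S.frameDomain j) (X : TangentSpace (𝓡 5) x) :
    (S.transition i j x : End5) * S.connForm D j x X =
      mvfderiv (𝓡 5) (fun z => (S.transition i j z : End5)) x X
        + S.connForm D i x X * (S.transition i j x : End5) := by
  have ha := mdifferentiableAt_transition hi hj
  have key (k : Fin 5) : D (fun z => S.frame j z (stdVec k)) x X =
      ∑ l, (S.transition i j x (stdVec k) l • D (fun z => S.frame i z (stdVec l)) x X +
        mvfderiv (𝓡 5) (fun z => (S.transition i j z : End5)) x X (stdVec k) l •
          S.frame i x (stdVec l)) := by
    let c : Fin 5 → M → ℝ := fun l z => S.transition i j z (stdVec k) l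
    let L : Fin 5 → End5 →L[ℝ] ℝ := fun l =>
      (EuclideanSpace.proj l : E5 →L[ℝ] ℝ) ∘L ContinuousLinearMap.apply ℝ E5 (stdVec k)
    have hc (l) : MDifferentiableAt (𝓡 5) 𝓘(ℝ, ℝ) (c l) x :=
      (L l).differentiableAt.mdifferentiableAt.comp x ha
    have hdc (l) : mvfderiv (𝓡 5) (c l) x X =
        mvfderiv (𝓡 5) (fun z => (S.transition i j z : End5)) x X (stdVec k) l := by
      have h := mfderiv_comp x (L l).differentiableAt.mdifferentiableAt ha
      rw [mfderiv_eq_fderiv, (L l).fderiv] at h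
      exact congrArg (fun A => A X) h
    have e : (fun z => S.frame j z (stdVec k)) =
        fun z => ∑ l, (c l • fun z => S.frame i z (stdVec l)) z := by
      funext z
      rw [← S.frame_transition i j z, ← sum_coord (S.transition i j z (stdVec k)), map_sum]
      simp only [map_smul]
      rfl
    rw [e, D.map_sum fun l _ => (hc l).smul_section (mdifferentiableAt_frame hi (stdVec l)),
      sum_apply]
    refine Finset.sum_congr rfl fun l _ => ?_
    rw [D.isCovariantDerivativeOn.leibniz (s := Set.univ) (mdifferentiableAt_frame hi (stdVec l))
      (hc l), ← hdc]
    rfl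
  have hk (k) : ((S.transition i j x : End5) * S.connForm D j x X) (stdVec k) =
      (mvfderiv (𝓡 5) (fun z => (S.transition i j z : End5)) x X
        + S.connForm D i x X * (S.transition i j x : End5)) (stdVec k) := by
    rw [end5_mul_apply, connForm_apply_stdVec, key, add_apply, end5_mul_apply,
      connForm_apply, ← sum_coord (mvfderiv (𝓡 5) (fun z => (S.transition i j z : End5)) x X
        (stdVec k)), ← Finset.sum_add_distrib]
    simp only [map_sum, map_add, map_smul, transition, sum_coord]
    refine Finset.sum_congr rfl fun l _ => ?_
    simp [add_comm]
  ext1 v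
  rw [clm_apply_eq_sum, clm_apply_eq_sum _ v]
  simp only [hk]

/-- The covariant differential of the tautological section: the vertical part of `w`, expressed as
an endomorphism of `ℝ⁵` by means of the frame `S.frame i`. -/
def vertAt (S : SO3Structure M) (D : Cov M) (i : M) (σ : S.Twistor) (w : S.TTwistor σ) : End5 :=
  kappa (S.dFiber i σ w) +
    (S.connForm D i σ.proj (S.dproj σ w) * kappa (S.fiberCoordE i σ)
      - kappa (S.fiberCoordE i σ) * S.connForm D i σ.proj (S.dproj σ w))

lemma kappa_mul_transition (i j : M) (σ : S.Twistor) :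
    kappa (S.fiberCoordE i σ) * (S.transition i j σ.proj : End5) =
      (S.transition i j σ.proj : End5) * kappa (S.fiberCoordE j σ) := by
  rw [kappa_fiberCoordE, kappa_fiberCoordE]
  ext1 v
  simp [inFrame, transition]

/-- The covariant differential of the tautological section does not depend on the frame. -/
lemma vertAt_mul_transition (D : Cov M) {i j : M} {σ : S.Twistor} (hi : σ.proj ∈ S.frameDomain i)
    (hj : σ.proj ∈ S.frameDomain j) (w : S.TTwistor σ) :
    S.vertAt D i σ w * (S.transition i j σ.proj : End5) =
      (S.transition i j σ.proj : End5) * S.vertAt D j σ w := by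
  have hK (i : M) (hi : σ.proj ∈ S.frameDomain i) :
      MDifferentiableAt ((𝓡 5).prod (𝓡 2)) 𝓘(ℝ, End5) (fun τ => kappaL (S.fiberCoordE i τ)) σ ∧
      mvfderiv ((𝓡 5).prod (𝓡 2)) (fun τ => kappaL (S.fiberCoordE i τ)) σ w =
        kappa (S.dFiber i σ w) := by
    have h0 := mdifferentiableAt_fiberCoordE hi
    refine ⟨kappaL.differentiableAt.mdifferentiableAt.comp σ h0, ?_⟩
    have h := mfderiv_comp σ (kappaL.differentiableAt (x := S.fiberCoordE i σ)).mdifferentiableAt h0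
    rw [mfderiv_eq_fderiv, kappaL.fderiv] at h
    exact (congrArg (fun A => A w) h).trans (kappaL_apply _)
  have ha := mdifferentiableAt_transition hi hj
  have hb : MDifferentiableAt ((𝓡 5).prod (𝓡 2)) 𝓘(ℝ, End5)
      (fun τ : S.Twistor => (S.transition i j τ.proj : End5)) σ :=
    ha.comp σ (mdifferentiableAt_proj σ)
  have hda : mvfderiv ((𝓡 5).prod (𝓡 2))
      (fun τ : S.Twistor => (S.transition i j τ.proj : End5)) σ w =
      mvfderiv (𝓡 5) (fun z => (S.transition i j z : End5)) σ.proj (S.dproj σ w) :=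
    congrArg (fun A => A w) (mfderiv_comp σ ha (mdifferentiableAt_proj σ))
  have e : (fun τ : S.Twistor => kappaL (S.fiberCoordE i τ) * (S.transition i j τ.proj : End5)) =
      fun τ => (S.transition i j τ.proj : End5) * kappaL (S.fiberCoordE j τ) := by
    funext τ
    simpa only [kappaL_apply] using kappa_mul_transition i j τ
  have h1 := mvfderiv_end5_mul (hK i hi).1 hb w
  have h2 := mvfderiv_end5_mul hb (hK j hj).1 w
  rw [e, h2, (hK i hi).2, (hK j hj).2, hda, kappaL_apply, kappaL_apply] at h1
  have h3 := transition_mul_connForm D hi hj (S.dproj σ w)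
  have h4 := kappa_mul_transition i j σ
  unfold vertAt
  generalize (S.transition i j σ.proj : End5) = a at *
  generalize mvfderiv (𝓡 5) (fun z => (S.transition i j z : End5)) σ.proj (S.dproj σ w) = da at *
  generalize kappa (S.fiberCoordE i σ) = K at *
  generalize kappa (S.fiberCoordE j σ) = K' at *
  generalize S.connForm D i σ.proj (S.dproj σ w) = o at *
  generalize S.connForm D j σ.proj (S.dproj σ w) = o' at *
  have h5 : o * a = a * o' - da := by rw [h3]; abel
  have h6 : kappa (S.dFiber i σ w) * a = a * kappa (S.dFiber j σ w) + da * K' - K * da := by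
    rw [h1]; abel
  have e1 : o * K * a = a * o' * K' - da * K' := by
    rw [mul_assoc, h4, ← mul_assoc, h5, sub_mul]
  have e2 : K * o * a = a * K' * o' - K * da := by
    rw [mul_assoc, h5, mul_sub, ← mul_assoc, h4]
  rw [add_mul, sub_mul, e1, e2, h6, mul_add, mul_sub, mul_assoc a o', mul_assoc a K']
  abel

end SO3Structure
end Gauge

/-! ### The tensors `Φ` and `η` in local coordinates -/

section Tensors

variable {M : Type*} [TopologicalSpace M] [ChartedSpace E5 M] [IsManifold (𝓡 5) ∞ M]
namespace SO3Structure
variable {S : SO3Structure M}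

lemma inner_cross_self (y v : E3) : ⟪y, cross y v⟫_ℝ = 0 := by
  rw [cross_apply]
  simp [PiLp.inner_apply, Fin.sum_univ_three]
  ring

lemma inner_self_cross (y v : E3) : ⟪y, cross v y⟫_ℝ = 0 := by
  rw [cross_apply]
  simp [PiLp.inner_apply, Fin.sum_univ_three]
  ring

/-- The connection form of an `SO(3)`-connection takes values in the Lie algebra of `ι(SO(3))`,
which is the image of `kappa`. -/
lemma IsSO3Connection.exists_connForm_eq_kappa {D : Cov M} (hD : S.IsSO3Connection D) {i x : M}
    (h : x ∈ S.frameDomain i) (X : TangentSpace (𝓡 5) x) : ∃ z, S.connForm D i x X = kappa z := by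
  obtain ⟨B, hB, hL⟩ := hD _ (S.frame i) (S.isOpen_frameDomain i)
    (fun x _ => S.frame_mem i x) (S.isSmoothFrameOn_frame i) x h X
  obtain ⟨z, rfl⟩ := exists_skew hB
  refine ⟨z, ?_⟩
  have hk (k) : S.connForm D i x X (stdVec k) = kappa z (stdVec k) := by
    apply mu_injective
    rw [connForm_apply_stdVec, mu_kappa, ← hL]
  ext1 v
  rw [clm_apply_eq_sum, clm_apply_eq_sum _ v]
  simp only [hk]

lemma inducedForm_apply (D : Cov M) (σ : S.Twistor) (X : TangentSpace (𝓡 5) σ.proj) :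
    S.inducedForm D σ X = kappaCoord
      (S.connForm D σ.proj σ.proj X * kappa (S.fiberCoordE σ.proj σ)
        - kappa (S.fiberCoordE σ.proj σ) * S.connForm D σ.proj σ.proj X) := by
  rw [← S.point_eq]; rfl

/-- The connection of `Λ²₃` is the commutator with the connection form, because `Λ²₃` is invariant under
`ι(SO(3))`; it preserves the metric. -/
lemma IsSO3Connection.kappa_inducedForm {D : Cov M} (hD : S.IsSO3Connection D) (σ : S.Twistor)
    (X : TangentSpace (𝓡 5) σ.proj) : kappa (S.inducedForm D σ X) =
      S.connForm D σ.proj σ.proj X * kappa (S.fiberCoordE σ.proj σ)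
        - kappa (S.fiberCoordE σ.proj σ) * S.connForm D σ.proj σ.proj X ∧
    ⟪S.fiberCoordE σ.proj σ, S.inducedForm D σ X⟫_ℝ = 0 := by
  obtain ⟨z, hz⟩ := hD.exists_connForm_eq_kappa (S.mem_frameDomain σ.proj) X
  have h := kappa_commutator z (S.fiberCoordE σ.proj σ)
  have hn : -kappa (cross z (S.fiberCoordE σ.proj σ)) =
      kappa (-cross z (S.fiberCoordE σ.proj σ)) := by simp only [← kappaL_apply, map_neg]
  rw [hn] at h
  rw [inducedForm_apply, hz]
  change kappa (kappaCoord (kappa z ∘L _ - _ ∘L kappa z)) = kappa z ∘L _ - _ ∘L kappa z ∧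
    ⟪_, kappaCoord (kappa z ∘L _ - _ ∘L kappa z)⟫_ℝ = 0
  rw [h, kappaCoord_kappa, inner_neg_right, inner_self_cross, neg_zero]
  exact ⟨rfl, rfl⟩

lemma IsSO3Connection.kappa_vertPart {D : Cov M} (hD : S.IsSO3Connection D) (σ : S.Twistor)
    (w : S.TTwistor σ) : kappa (S.vertPart D σ w) = S.vertAt D σ.proj σ w := by
  rw [vertAt, ← (hD.kappa_inducedForm σ _).1]
  simp only [← kappaL_apply, ← map_add]
  rfl

lemma dproj_hLift (D : Cov M) (σ : S.Twistor) (X : TangentSpace (𝓡 5) σ.proj) :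
    S.dproj σ (S.hLift D σ X) = X :=
  dproj_liftAt (S.mem_frameDomain σ.proj) (X, -S.inducedForm D σ X)

lemma IsSO3Connection.vertPart_hLift {D : Cov M} (hD : S.IsSO3Connection D) (σ : S.Twistor)
    (X : TangentSpace (𝓡 5) σ.proj) : S.vertPart D σ (S.hLift D σ X) = 0 := by
  have h : S.dFiber σ.proj σ (S.hLift D σ X) = -S.inducedForm D σ X :=
    dFiber_liftAt (S.mem_frameDomain σ.proj) (w := (X, -S.inducedForm D σ X)) (by
      rw [inner_neg_right, (hD.kappa_inducedForm σ X).2, neg_zero])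
  change S.dFiber σ.proj σ (S.hLift D σ X) + S.inducedForm D σ (S.dproj σ (S.hLift D σ X)) = 0
  rw [h, dproj_hLift, neg_add_cancel]

lemma dproj_vLift (σ : S.Twistor) (u : E3) : S.dproj σ (S.vLift σ u) = 0 :=
  dproj_liftAt (S.mem_frameDomain σ.proj) ((0 : TangentSpace (𝓡 5) σ.proj), u)

lemma vertPart_vLift (D : Cov M) (σ : S.Twistor) {u : E3}
    (hu : ⟪S.fiberCoordE σ.proj σ, u⟫_ℝ = 0) : S.vertPart D σ (S.vLift σ u) = u := by
  have h : S.dFiber σ.proj σ (S.vLift σ u) = u :=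
    dFiber_liftAt (S.mem_frameDomain σ.proj) (w := ((0 : TangentSpace (𝓡 5) σ.proj), u)) hu
  change S.dFiber σ.proj σ (S.vLift σ u) + S.inducedForm D σ (S.dproj σ (S.vLift σ u)) = u
  rw [h, dproj_vLift, map_zero, add_zero]

lemma Phi_apply (D : Cov M) (n : ℕ) (ε : ℝ) (σ : S.Twistor) (w : S.TTwistor σ) :
    S.Phi D n ε σ w = S.hLift D σ (S.frame σ.proj σ.proj
        (phi ε (S.point σ) ((S.frame σ.proj σ.proj).symm (S.dproj σ w))))
      + (-1 : ℝ) ^ n • S.vLift σ (cross (S.fiberCoordE σ.proj σ) (S.vertPart D σ w)) := rfl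

/-- The horizontal part of `Φ` can be computed in any adapted frame. -/
lemma dproj_Phi (D : Cov M) (n : ℕ) (ε : ℝ) {i : M} (σ : S.Twistor) (w : S.TTwistor σ) :
    S.dproj σ (S.Phi D n ε σ w) = S.frame i σ.proj
      (phi ε (kappa (S.fiberCoordE i σ)) ((S.frame i σ.proj).symm (S.dproj σ w))) := by
  rw [Phi_apply, map_add, map_smul, dproj_hLift, dproj_vLift, smul_zero, add_zero, S.point_eq]
  have h := phi_kappa_semiconj ε (S.norm_fiberCoordE σ.proj σ) (S.norm_fiberCoordE i σ)
    (kappa_mul_transition i σ.proj σ)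
  have h' := congrArg (fun A : End5 => A ((S.frame σ.proj σ.proj).symm (S.dproj σ w))) h
  simp only [end5_mul_apply, ContinuousLinearEquiv.coe_coe] at h'
  rw [← S.frame_transition i σ.proj σ.proj, ← h']
  simp [transition]

lemma IsSO3Connection.vertPart_Phi {D : Cov M} (hD : S.IsSO3Connection D) (n : ℕ) (ε : ℝ)
    (σ : S.Twistor) (w : S.TTwistor σ) : S.vertPart D σ (S.Phi D n ε σ w) =
      (-1 : ℝ) ^ n • cross (S.fiberCoordE σ.proj σ) (S.vertPart D σ w) := by
  rw [Phi_apply, map_add, map_smul, hD.vertPart_hLift, vertPart_vLift D σ (inner_cross_self _ _),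
    zero_add]

/-- The vertical part of `Φ` can be computed in any adapted frame; up to sign, the vector
product of `Λ²₃` is the commutator of endomorphisms. -/
lemma IsSO3Connection.vertAt_Phi {D : Cov M} (hD : S.IsSO3Connection D) (n : ℕ) (ε : ℝ) {i : M}
    {σ : S.Twistor} (hi : σ.proj ∈ S.frameDomain i) (w : S.TTwistor σ) :
    S.vertAt D i σ (S.Phi D n ε σ w) = (-1 : ℝ) ^ n •
      (S.vertAt D i σ w * kappa (S.fiberCoordE i σ)
        - kappa (S.fiberCoordE i σ) * S.vertAt D i σ w) := by
  have hj := S.mem_frameDomain σ.proj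
  have h1 : S.vertAt D σ.proj σ (S.Phi D n ε σ w) = (-1 : ℝ) ^ n •
      (S.vertAt D σ.proj σ w * kappa (S.fiberCoordE σ.proj σ)
        - kappa (S.fiberCoordE σ.proj σ) * S.vertAt D σ.proj σ w) := by
    rw [← hD.kappa_vertPart, ← hD.kappa_vertPart, hD.vertPart_Phi, ← kappaL_apply, map_smul,
      kappaL_apply]
    congr 1
    rw [← neg_sub]
    exact (neg_eq_iff_eq_neg.2 (kappa_commutator _ _)).symm
  have h2 := vertAt_mul_transition D hi hj (S.Phi D n ε σ w)
  have h3 := vertAt_mul_transition D hi hj w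
  have h4 := kappa_mul_transition i σ.proj σ
  have hinv : (S.transition i σ.proj σ.proj : End5) *
      ((S.transition i σ.proj σ.proj).symm : End5) = 1 := by
    ext1 v; simp
  rw [h1, mul_smul_comm, mul_sub, ← mul_assoc, ← h3, ← mul_assoc, ← h4, mul_assoc, ← h4,
    mul_assoc _ _ (S.vertAt D σ.proj σ w), ← h3, ← mul_assoc, ← mul_assoc, ← sub_mul,
    ← smul_mul_assoc] at h2
  have h5 := congrArg (· * ((S.transition i σ.proj σ.proj).symm : End5)) h2
  simpa only [mul_assoc, hinv, mul_one] using h5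

/-- `Φ` in the coordinates defined by the frame `S.frame i`. -/
lemma IsSO3Connection.Phi_eq_liftAt {D : Cov M} (hD : S.IsSO3Connection D) (n : ℕ) (ε : ℝ) {i : M}
    {σ : S.Twistor} (hi : σ.proj ∈ S.frameDomain i) (w : S.TTwistor σ) :
    S.Phi D n ε σ w = S.liftAt i σ
      (S.dproj σ (S.Phi D n ε σ w), kappaCoord ((-1 : ℝ) ^ n •
        (S.vertAt D i σ w * kappa (S.fiberCoordE i σ)
          - kappa (S.fiberCoordE i σ) * S.vertAt D i σ w) -
        (S.connForm D i σ.proj (S.dproj σ (S.Phi D n ε σ w)) * kappa (S.fiberCoordE i σ)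
          - kappa (S.fiberCoordE i σ) *
            S.connForm D i σ.proj (S.dproj σ (S.Phi D n ε σ w))))) := by
  conv_lhs => rw [← liftAt_dproj_dFiber hi (S.Phi D n ε σ w)]
  rw [← hD.vertAt_Phi n ε hi w]
  simp only [vertAt, add_sub_cancel_right, kappaCoord_kappa]

/-- `η` can be computed in any adapted frame; it does not depend on `t` since `χ` is horizontal. -/
lemma IsSO3Connection.eta_apply {D : Cov M} (hD : S.IsSO3Connection D) (t : ℝ) (i : M)
    (σ : S.Twistor) (w : S.TTwistor σ) : S.eta D t σ w =
      ⟪(S.frame i σ.proj).symm (S.dproj σ w), xi (kappa (S.fiberCoordE i σ))⟫_ℝ := by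
  have h0 : kappa (0 : E3) = 0 := by rw [← kappaL_apply, map_zero]
  have h1 : S.eta D t σ w = ⟪(S.frame σ.proj σ.proj).symm (S.dproj σ w),
      (S.frame σ.proj σ.proj).symm (S.dproj σ (S.chi D σ))⟫_ℝ +
      t * ip (kappa (S.vertPart D σ w)) (kappa (S.vertPart D σ (S.chi D σ))) := rfl
  rw [h1, chi, hD.vertPart_hLift, dproj_hLift, ip_kappa, inner_zero_right,
    ContinuousLinearEquiv.symm_apply_apply, S.point_eq, mul_zero, mul_zero, add_zero,
    ← (isIota_transition (S := S) i σ.proj σ.proj).map_xi (S.norm_fiberCoordE σ.proj σ)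
      (S.norm_fiberCoordE i σ) (kappa_mul_transition i σ.proj σ),
    ← (isIota_transition (S := S) i σ.proj σ.proj).inner_map]
  simp [transition]

end SO3Structure
end Tensors

/-! ### Smoothness of frames, connection forms and lifts -/

section Smoothness

lemma contMDiffAt_tangentBundle_modelSpace {E H N F : Type*} [NormedAddCommGroup E]
    [NormedSpace ℝ E] [TopologicalSpace H] {I : ModelWithCorners ℝ E H} [TopologicalSpace N]
    [ChartedSpace H N] [NormedAddCommGroup F] [NormedSpace ℝ F] {f v : N → F} {q : N}
    (hf : ContMDiffAt I 𝓘(ℝ, F) ∞ f q) (hv : ContMDiffAt I 𝓘(ℝ, F) ∞ v q) :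
    ContMDiffAt I 𝓘(ℝ, F).tangent ∞ (fun r => (⟨f r, v r⟩ : TangentBundle 𝓘(ℝ, F) F)) q := by
  have h := contMDiffAt_totalSpace (F := F) (E := TangentSpace 𝓘(ℝ, F)) (IB := 𝓘(ℝ, F)) (IM := I)
    (f := fun r => (⟨f r, v r⟩ : TangentBundle 𝓘(ℝ, F) F)) (n := ∞) (x₀ := q)
  refine h.2 ⟨hf, ?_⟩
  simpa using hv

variable {M : Type*} [TopologicalSpace M] [ChartedSpace E5 M] [IsManifold (𝓡 5) ∞ M]
namespace SO3Structure
variable {S : SO3Structure M}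

section
variable {E H N : Type*} [NormedAddCommGroup E] [NormedSpace ℝ E]
  [TopologicalSpace H] {I : ModelWithCorners ℝ E H} [TopologicalSpace N] [ChartedSpace H N]

/-- Smooth components in an adapted frame give a smooth vector field along a map. -/
lemma contMDiffAt_frame_apply {i : M} {f : N → M} {a : N → E5} {q : N}
    (h : f q ∈ S.frameDomain i) (hf : ContMDiffAt I (𝓡 5) ∞ f q)
    (ha : ContMDiffAt I 𝓘(ℝ, E5) ∞ a q) :
    ContMDiffAt I (𝓡 5).tangent ∞
      (fun r => (⟨f r, S.frame i (f r) (a r)⟩ : TangentBundle (𝓡 5) M)) q := by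
  rw [contMDiffAt_totalSpace]
  refine ⟨hf, ?_⟩
  have h1 := ((S.frameInTriv_contMDiffAt h).comp q hf).clm_apply ha
  refine h1.congr_of_eventuallyEq ?_
  have hb := hf.continuousAt.preimage_mem_nhds
    ((trivializationAt E5 (TangentSpace (𝓡 5)) (f q)).open_baseSet.mem_nhds
      (FiberBundle.mem_baseSet_trivializationAt' (f q)))
  filter_upwards [hb] with r hr
  rw [Function.comp_apply, S.frameInTriv_apply i hr]
  rfl

lemma contMDiffAt_frame_symm {i : M} {Z : ∀ x : M, TangentSpace (𝓡 5) x} {x : M}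
    (h : x ∈ S.frameDomain i) (hZ : ContMDiffAt (𝓡 5) (𝓡 5).tangent ∞
      (fun z => (⟨z, Z z⟩ : TangentBundle (𝓡 5) M)) x) :
    ContMDiffAt (𝓡 5) 𝓘(ℝ, E5) ∞ (fun z => (S.frame i z).symm (Z z)) x := by
  have h1 : ContMDiffAt (𝓡 5) 𝓘(ℝ, End5) ∞ (fun z => (S.frameInTriv i x z).inverse) x := by
    have : ContDiffAt ℝ ∞ ContinuousLinearMap.inverse (S.frameInTriv i x x) := by
      rw [S.frameInTriv_apply i (FiberBundle.mem_baseSet_trivializationAt' x)]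
      exact contDiffAt_map_inverse _
    exact this.contMDiffAt.comp x (S.frameInTriv_contMDiffAt h)
  refine (h1.clm_apply (contMDiffAt_totalSpace.1 hZ).2).congr_of_eventuallyEq ?_
  filter_upwards [(trivializationAt E5 (TangentSpace (𝓡 5)) x).open_baseSet.mem_nhds
    (FiberBundle.mem_baseSet_trivializationAt' x)] with z hz
  rw [S.frameInTriv_apply i hz, ContinuousLinearMap.inverse_equiv]
  simp [Bundle.Trivialization.symm_apply_apply_mk _ hz]

/-- A smooth connection is smooth on local sections. -/
lemma contMDiffAt_cov [T2Space M] {D : Cov M}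
    (hD : CovariantDerivative.ContMDiffCovariantDerivative D ∞)
    {Z : ∀ x : M, TangentSpace (𝓡 5) x} {U : Set M} (hU : IsOpen U) {x : M} (hx : x ∈ U)
    (hZ : ContMDiffOn (𝓡 5) (𝓡 5).tangent ∞ (fun z => (⟨z, Z z⟩ : TangentBundle (𝓡 5) M)) U) :
    ContMDiffAt (𝓡 5) ((𝓡 5).prod 𝓘(ℝ, E5 →L[ℝ] E5)) ∞
      (fun z => (⟨z, D Z z⟩ : TotalSpace (E5 →L[ℝ] E5)
        fun z : M => TangentSpace (𝓡 5) z →L[ℝ] TangentSpace (𝓡 5) z)) x := by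
  -- a bump function extends the section to the whole manifold
  obtain ⟨ψ, -, hψ⟩ := (SmoothBumpFunction.nhds_basis_tsupport (I := 𝓡 5) x).mem_iff.1
    (hU.mem_nhds hx)
  have h1 : ContMDiff (𝓡 5) (𝓡 5).tangent ∞
      (fun z => (⟨z, ((ψ : M → ℝ) • Z) z⟩ : TangentBundle (𝓡 5) M)) :=
    ContMDiffOn.smul_section_of_tsupport ψ.contMDiff.contMDiffOn hU hψ hZ
  have h2 := hD.contMDiff.contMDiff (σ := (ψ : M → ℝ) • Z)
    (by exact h1.contMDiffOn)
  refine ((h2 x trivial).contMDiffAt Filter.univ_mem).congr_of_eventuallyEq ?_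
  filter_upwards [eventually_eventually_nhds.2 ψ.eventuallyEq_one, hU.mem_nhds hx] with z hz hzU
  have : D Z z = D ((ψ : M → ℝ) • Z) z := by
    refine D.isCovariantDerivativeOn.congr_of_eventuallyEq (s := Set.univ)
      ((hZ.contMDiffAt (hU.mem_nhds hzU)).mdifferentiableAt (by simp))
      ((h1 z).mdifferentiableAt (by simp)) Filter.univ_mem ?_
    filter_upwards [hz] with r hr
    simp [hr]
  rw [this]

lemma contMDiffAt_connForm [T2Space M] {D : Cov M}
    (hD : CovariantDerivative.ContMDiffCovariantDerivative D ∞)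
    {i : M} {f : N → M} {a : N → E5} {q : N}
    (h : f q ∈ S.frameDomain i) (hf : ContMDiffAt I (𝓡 5) ∞ f q)
    (ha : ContMDiffAt I 𝓘(ℝ, E5) ∞ a q) :
    ContMDiffAt I 𝓘(ℝ, End5) ∞
      (fun r => S.connForm D i (f r) (S.frame i (f r) (a r))) q := by
  have hc (j k : Fin 5) : ContMDiffAt (𝓡 5) 𝓘(ℝ, E5) ∞ (fun z => (S.frame i z).symm
      (D (fun z => S.frame i z (stdVec k)) z (S.frame i z (stdVec j)))) (f q) := by
    refine contMDiffAt_frame_symm h ?_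
    exact (contMDiffAt_cov hD (S.isOpen_frameDomain i) h
      (S.isSmoothFrameOn_frame i (stdVec k))).clm_bundle_apply
        ((S.isSmoothFrameOn_frame i (stdVec j)).contMDiffAt ((S.isOpen_frameDomain i).mem_nhds h))
  have e : (fun r => S.connForm D i (f r) (S.frame i (f r) (a r))) = fun r => ∑ k, ∑ j, a r j •
      ContinuousLinearMap.smulRightL ℝ E5 E5 (EuclideanSpace.proj k) ((S.frame i (f r)).symm
        (D (fun z => S.frame i z (stdVec k)) (f r) (S.frame i (f r) (stdVec j)))) := by
    funext r
    conv_lhs => rw [← sum_coord (a r)]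
    rw [map_sum, map_sum, Finset.sum_comm]
    refine Finset.sum_congr rfl fun j _ => ?_
    rw [map_smul, map_smul]
    ext1 v
    simp [connForm_apply, Finset.smul_sum]
  rw [e]
  refine ContMDiffAt.sum fun k _ => ContMDiffAt.sum fun j _ => ?_
  have h1 : ContMDiffAt I 𝓘(ℝ, ℝ) ∞ (fun r => a r j) q :=
    ((EuclideanSpace.proj j : E5 →L[ℝ] ℝ).contDiff.contMDiff.contMDiffAt).comp q ha
  have h2 := ((ContinuousLinearMap.smulRightL ℝ E5 E5
    (EuclideanSpace.proj k)).contDiff.contMDiff.contMDiffAt (n := ∞)).comp q ((hc j k).comp q hf)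
  exact ContMDiffAt.smul h1 h2
end

/-- Smooth coefficients in the coordinates defined by a frame give a smooth vector field. -/
lemma contMDiffAt_liftAt {i : M} {a : S.Twistor → E5} {v : S.Twistor → E3} {σ : S.Twistor}
    (h : σ.proj ∈ S.frameDomain i)
    (ha : ContMDiffAt ((𝓡 5).prod (𝓡 2)) 𝓘(ℝ, E5) ∞ a σ)
    (hv : ContMDiffAt ((𝓡 5).prod (𝓡 2)) 𝓘(ℝ, E3) ∞ v σ) :
    ContMDiffAt ((𝓡 5).prod (𝓡 2)) ((𝓡 5).prod (𝓡 2)).tangent ∞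
      (fun τ => (⟨τ, S.liftAt i τ (S.frame i τ.proj (a τ), v τ)⟩ :
        TangentBundle ((𝓡 5).prod (𝓡 2)) S.Twistor)) σ := by
  let O : Set (M × E3) := S.frameDomain i ×ˢ {0}ᶜ
  have hO : IsOpen O := (S.isOpen_frameDomain i).prod isOpen_compl_singleton
  have h1 : ContMDiffOn ((𝓡 5).prod 𝓘(ℝ, E3)) ((𝓡 5).prod (𝓡 2)) ∞ (S.pointOf i) O :=
    fun q hq => (S.contMDiffAt_pointOf hq.1 hq.2).contMDiffWithinAt
  have h2 := h1.contMDiffOn_tangentMapWithin (m := ∞) (by simp) hO.uniqueMDiffOn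
  let s : S.Twistor → TangentBundle ((𝓡 5).prod 𝓘(ℝ, E3)) (M × E3) := fun τ =>
    ⟨(τ.proj, S.fiberCoordE i τ), (S.frame i τ.proj (a τ), v τ)⟩
  have hs : ContMDiffAt ((𝓡 5).prod (𝓡 2)) ((𝓡 5).prod 𝓘(ℝ, E3)).tangent ∞ s σ := by
    have h3 := contMDiffAt_frame_apply h (S.contMDiff_proj σ) ha
    have h4 : ContMDiffAt ((𝓡 5).prod (𝓡 2)) 𝓘(ℝ, E3).tangent ∞
        (fun τ => (⟨S.fiberCoordE i τ, v τ⟩ : TangentBundle 𝓘(ℝ, E3) E3)) σ :=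
      contMDiffAt_tangentBundle_modelSpace (S.contMDiffAt_fiberCoordE h) hv
    exact (contMDiff_equivTangentBundleProd_symm (n := ∞) (I := 𝓡 5) (M := M)
      (I' := 𝓘(ℝ, E3)) (M' := E3)).contMDiffAt.comp σ (h3.prodMk h4)
  have h5 := (h2.contMDiffAt ((hO.preimage (FiberBundle.continuous_proj _ _)).mem_nhds
    (⟨h, S.fiberCoordE_ne_zero i σ⟩ : (s σ).proj ∈ O))).comp σ hs
  refine h5.congr_of_eventuallyEq ?_
  filter_upwards [((S.isOpen_frameDomain i).preimage (S.contMDiff_proj.continuous)).mem_nhds h]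
    with τ hτ
  have h6 := mfderivWithin_of_isOpen (I := (𝓡 5).prod 𝓘(ℝ, E3)) (I' := (𝓡 5).prod (𝓡 2))
    (f := S.pointOf i) hO (⟨hτ, S.fiberCoordE_ne_zero i τ⟩ : (τ.proj, S.fiberCoordE i τ) ∈ O)
  refine TotalSpace.ext (S.pointOf_fiberCoordE i τ).symm (heq_of_eq ?_)
  exact congrArg (fun A => A (S.frame i τ.proj (a τ), v τ)) h6.symm

end SO3Structure
end Smoothness

section Circle

variable {E H N : Type*} [NormedAddCommGroup E] [NormedSpace ℝ E]
  [TopologicalSpace H] {I : ModelWithCorners ℝ E H} [TopologicalSpace N] [ChartedSpace H N]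

/-- `d/dθ` is obtained from the differential of the smooth map `(s, z) ↦ z exp(is)`. -/
lemma contMDiffAt_smul_circleField {f : N → Circle} {g : N → ℝ} {q : N}
    (hf : ContMDiffAt I (𝓡 1) ∞ f q) (hg : ContMDiffAt I 𝓘(ℝ, ℝ) ∞ g q) :
    ContMDiffAt I (𝓡 1).tangent ∞
      (fun r => (⟨f r, g r • circleField (f r)⟩ : TangentBundle (𝓡 1) Circle)) q := by
  let F : ℝ × Circle → Circle := fun p => p.2 * Circle.exp p.1
  have hF : ContMDiff (𝓘(ℝ, ℝ).prod (𝓡 1)) (𝓡 1) ∞ F :=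
    contMDiff_snd.mul (contMDiff_circleExp.comp contMDiff_fst)
  have h1 := hF.contMDiff_tangentMap (m := ∞) (by simp)
  have h2 : ContMDiffAt I 𝓘(ℝ, ℝ).tangent ∞
      (fun r => (⟨0, g r⟩ : TangentBundle 𝓘(ℝ, ℝ) ℝ)) q :=
    contMDiffAt_tangentBundle_modelSpace contMDiffAt_const hg
  have h3 : ContMDiffAt I (𝓡 1).tangent ∞
      (fun r => (⟨f r, 0⟩ : TangentBundle (𝓡 1) Circle)) q :=
    (contMDiff_zeroSection ℝ (TangentSpace (𝓡 1) : Circle → Type _)).contMDiffAt.comp q hf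
  have h4 := (contMDiff_equivTangentBundleProd_symm (n := ∞) (I := 𝓘(ℝ, ℝ)) (M := ℝ)
      (I' := 𝓡 1) (M' := Circle)).contMDiffAt.comp q (h2.prodMk h3)
  refine (h1.contMDiffAt.comp q h4).congr_of_eventuallyEq (.of_forall fun r => ?_)
  have e : F (0, f r) = f r := by simp [F]
  refine TotalSpace.ext e.symm (heq_of_eq ?_)
  -- the curve `s ↦ z exp(is)` is the restriction of `F` to `ℝ × {z}`
  have h5 := mfderiv_comp_apply (I := 𝓘(ℝ, ℝ)) (I' := 𝓘(ℝ, ℝ).prod (𝓡 1)) (I'' := 𝓡 1)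
    (f := fun s : ℝ => (s, f r)) (g := F) (0 : ℝ)
    ((hF (0, f r)).mdifferentiableAt (by simp)) (mdifferentiableAt_id.prodMk
      mdifferentiableAt_const) (g r)
  have h6 : g r • circleField (f r) =
      mfderiv 𝓘(ℝ, ℝ) (𝓡 1) (F ∘ fun s : ℝ => (s, f r)) 0 (g r) := by
    let A : ℝ →L[ℝ] TangentSpace (𝓡 1) (f r * Circle.exp 0) :=
      mfderiv 𝓘(ℝ, ℝ) (𝓡 1) (F ∘ fun s : ℝ => (s, f r)) 0
    exact (A.map_smul (g r) 1).symm.trans (congrArg A (mul_one (g r)))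
  have h7 : mfderiv 𝓘(ℝ, ℝ) (𝓘(ℝ, ℝ).prod (𝓡 1)) (fun s : ℝ => (s, f r)) 0 (g r) =
      ((g r, 0) : ℝ × TangentSpace (𝓡 1) (f r)) := by
    exact congrArg (fun A => A (g r))
      (mfderiv_prod_left (I := 𝓘(ℝ, ℝ)) (I' := 𝓡 1) (x₀ := (0 : ℝ)) (y₀ := f r))
  exact h6.trans (h5.trans (congrArg _ h7))

/-- A vector field on a product is smooth if its components are smooth. -/
lemma contMDiffAt_prodField {E' H' N' : Type*} [NormedAddCommGroup E'] [NormedSpace ℝ E']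
    [TopologicalSpace H'] {I' : ModelWithCorners ℝ E' H'} [TopologicalSpace N'] [ChartedSpace H' N']
    [IsManifold I ∞ N] [IsManifold I' ∞ N'] {X : ∀ r : N × N', TangentSpace I r.1}
    {Y : ∀ r : N × N', TangentSpace I' r.2} {q : N × N'}
    (hX : ContMDiffAt (I.prod I') I.tangent ∞ (fun r => (⟨r.1, X r⟩ : TangentBundle I N)) q)
    (hY : ContMDiffAt (I.prod I') I'.tangent ∞ (fun r => (⟨r.2, Y r⟩ : TangentBundle I' N')) q) :
    ContMDiffAt (I.prod I') (I.prod I').tangent ∞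
      (fun r => (⟨r, (X r, Y r)⟩ : TangentBundle (I.prod I') (N × N'))) q :=
  (contMDiff_equivTangentBundleProd_symm (n := ∞) (I := I) (M := N)
      (I' := I') (M' := N')).contMDiffAt.comp q (hX.prodMk hY)

end Circle

/-! ### Coordinate fields and the almost complex structure on `𝕋 × S¹` -/

section CoordFields

variable {M : Type*} [TopologicalSpace M] [ChartedSpace E5 M] [IsManifold (𝓡 5) ∞ M]
namespace SO3Structure

/-- The vector field `∑ aₖ Eₖ + ∑ vⱼ ∂/∂yⱼ + g ∂/∂θ` on `𝕋 × S¹` in the coordinates `(x, y)` of `𝕋`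
defined by the adapted frame `E = S.frame i`. -/
def coordField (S : SO3Structure M) (i : M) (a : S.Twistor → E5) (v : S.Twistor → E3)
    (g : S.Twistor → ℝ) (q : S.Twistor × Circle) :
    TangentSpace (((𝓡 5).prod (𝓡 2)).prod (𝓡 1)) q :=
  ((S.liftAt i q.1 (S.frame i q.1.proj (a q.1), v q.1), g q.1 • circleField q.2) :
    S.TTwistor q.1 × TangentSpace (𝓡 1) q.2)

variable {S : SO3Structure M}

lemma contMDiffAt_coordField {i : M} {a : S.Twistor → E5} {v : S.Twistor → E3}
    {g : S.Twistor → ℝ} {q : S.Twistor × Circle} (h : q.1.proj ∈ S.frameDomain i)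
    (ha : ContMDiffAt ((𝓡 5).prod (𝓡 2)) 𝓘(ℝ, E5) ∞ a q.1)
    (hv : ContMDiffAt ((𝓡 5).prod (𝓡 2)) 𝓘(ℝ, E3) ∞ v q.1)
    (hg : ContMDiffAt ((𝓡 5).prod (𝓡 2)) 𝓘(ℝ, ℝ) ∞ g q.1) :
    ContMDiffAt (((𝓡 5).prod (𝓡 2)).prod (𝓡 1)) (((𝓡 5).prod (𝓡 2)).prod (𝓡 1)).tangent ∞
      (fun q => (⟨q, S.coordField i a v g q⟩ :
        TangentBundle (((𝓡 5).prod (𝓡 2)).prod (𝓡 1)) (S.Twistor × Circle))) q :=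
  contMDiffAt_prodField (I := (𝓡 5).prod (𝓡 2)) (I' := 𝓡 1)
    (ContMDiffAt.comp q (contMDiffAt_liftAt h ha hv) contMDiffAt_fst)
    (contMDiffAt_smul_circleField contMDiffAt_snd (ContMDiffAt.comp q hg contMDiffAt_fst))

lemma contMDiffAt_phi_apply (ε : ℝ) {i : M} {a : S.Twistor → E5} {σ : S.Twistor}
    (h : σ.proj ∈ S.frameDomain i) (ha : ContMDiffAt ((𝓡 5).prod (𝓡 2)) 𝓘(ℝ, E5) ∞ a σ) :
    ContMDiffAt ((𝓡 5).prod (𝓡 2)) 𝓘(ℝ, E5) ∞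
      (fun τ => phi ε (kappa (S.fiberCoordE i τ)) (a τ)) σ := by
  have h1 := S.contMDiffAt_fiberCoordE h
  have hK : ContDiff ℝ ∞ (fun y : E3 => ((1 + 5 / 2 * ε) / (2 + ε)) • kappaL y
      + (ε / 2 / (2 + ε)) • (kappaL y * kappaL y * kappaL y)) := by fun_prop
  refine ((hK.contMDiff.contMDiffAt.comp σ h1).clm_apply ha).congr_of_eventuallyEq
    (.of_forall fun τ => ?_)
  simp only [phi_kappa ε (S.norm_fiberCoordE i τ), Function.comp_apply, kappaL_apply]

lemma contMDiffAt_inner_xi {i : M} {a : S.Twistor → E5} {σ : S.Twistor}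
    (h : σ.proj ∈ S.frameDomain i) (ha : ContMDiffAt ((𝓡 5).prod (𝓡 2)) 𝓘(ℝ, E5) ∞ a σ) :
    ContMDiffAt ((𝓡 5).prod (𝓡 2)) 𝓘(ℝ, ℝ) ∞
      (fun τ => ⟪a τ, xi (kappa (S.fiberCoordE i τ))⟫_ℝ) σ := by
  have h1 := S.contMDiffAt_fiberCoordE h
  have hK : ContDiff ℝ ∞ (fun y : E3 => xi (kappa y)) := by
    simp only [xi_kappa]
    rw [contDiff_piLp]
    intro k
    fin_cases k <;> simp <;> fun_prop
  exact (contDiff_inner (𝕜 := ℝ) (E := E5)).contMDiff.contMDiffAt.comp σ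
    (ha.prodMk_space (hK.contMDiff.contMDiffAt.comp σ h1))

/-- The fibre components of `Φ w`, for `w` with components `a` in the frame `S.frame i` and `v` in
the fibre. -/
def phiFiber (S : SO3Structure M) (D : Cov M) (n : ℕ) (ε : ℝ) (i : M) (a : S.Twistor → E5)
    (v : S.Twistor → E3) (τ : S.Twistor) : E3 :=
  let K := kappaL (S.fiberCoordE i τ)
  let θ (b : E5) : End5 := S.connForm D i τ.proj (S.frame i τ.proj b)
  let V := kappaL (v τ) + (θ (a τ) * K - K * θ (a τ))
  kappaCoordL ((-1 : ℝ) ^ n • (V * K - K * V) -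
    (θ (phi ε (kappa (S.fiberCoordE i τ)) (a τ)) * K -
      K * θ (phi ε (kappa (S.fiberCoordE i τ)) (a τ))))

/-- The fibre components of `Φ w` are a polynomial in `y`, `v` and two values of the connection form. -/
lemma contMDiffAt_phiFiber [T2Space M] {D : Cov M}
    (hD : CovariantDerivative.ContMDiffCovariantDerivative D ∞) (n : ℕ) (ε : ℝ) {i : M}
    {a : S.Twistor → E5} {v : S.Twistor → E3} {σ : S.Twistor} (h : σ.proj ∈ S.frameDomain i)
    (ha : ContMDiffAt ((𝓡 5).prod (𝓡 2)) 𝓘(ℝ, E5) ∞ a σ)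
    (hv : ContMDiffAt ((𝓡 5).prod (𝓡 2)) 𝓘(ℝ, E3) ∞ v σ) :
    ContMDiffAt ((𝓡 5).prod (𝓡 2)) 𝓘(ℝ, E3) ∞ (S.phiFiber D n ε i a v) σ := by
  have hc {b : S.Twistor → E5} (hb : ContMDiffAt ((𝓡 5).prod (𝓡 2)) 𝓘(ℝ, E5) ∞ b σ) :=
    contMDiffAt_connForm hD h (S.contMDiff_proj σ) hb
  have hF : ContDiff ℝ ∞ (fun p : (E3 × E3) × (End5 × End5) => kappaCoordL ((-1 : ℝ) ^ n •
      ((kappaL p.1.2 + (p.2.1 * kappaL p.1.1 - kappaL p.1.1 * p.2.1)) * kappaL p.1.1 -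
        kappaL p.1.1 * (kappaL p.1.2 + (p.2.1 * kappaL p.1.1 - kappaL p.1.1 * p.2.1))) -
      (p.2.2 * kappaL p.1.1 - kappaL p.1.1 * p.2.2))) := by fun_prop
  have h1 := hF.contMDiff.contMDiffAt.comp σ (((S.contMDiffAt_fiberCoordE h).prodMk_space hv).prodMk_space
    ((hc ha).prodMk_space (hc (contMDiffAt_phi_apply ε h ha))))
  refine h1.congr_of_eventuallyEq (.of_forall fun τ => ?_)
  simp only [Function.comp_apply, phiFiber]

/-- The almost complex structure on `𝕋 × S¹` in coordinates, on vectors without `∂/∂θ` component. -/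
lemma IsSO3Connection.inducedJ_coordField {D : Cov M} (hD : S.IsSO3Connection D) (n : ℕ)
    (ε t : ℝ) {i : M} {a : S.Twistor → E5} {v : S.Twistor → E3} {q : S.Twistor × Circle}
    (h : q.1.proj ∈ S.frameDomain i) (hv : ⟪S.fiberCoordE i q.1, v q.1⟫_ℝ = 0) :
    inducedJ ((𝓡 5).prod (𝓡 2)) (S.Phi D n ε) (S.chi D) (S.eta D t) q
        (S.coordField i a v 0 q) =
      S.coordField i (fun τ => phi ε (kappa (S.fiberCoordE i τ)) (a τ)) (S.phiFiber D n ε i a v)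
        (fun τ => ⟪a τ, xi (kappa (S.fiberCoordE i τ))⟫_ℝ) q := by
  let w : S.TTwistor q.1 := S.liftAt i q.1 (S.frame i q.1.proj (a q.1), v q.1)
  have h1 : S.dproj q.1 w = S.frame i q.1.proj (a q.1) := dproj_liftAt h _
  have h2 : S.dFiber i q.1 w = v q.1 := dFiber_liftAt h hv
  have h3 : circleForm q.2 ((0 : ℝ) • circleField q.2) = 0 := by
    rw [zero_smul, circleForm, map_zero]
    exact congrArg Complex.im (mul_zero _)
  have h4 : S.dproj q.1 (S.Phi D n ε q.1 w) =
      S.frame i q.1.proj (phi ε (kappa (S.fiberCoordE i q.1)) (a q.1)) := by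
    rw [dproj_Phi (i := i), h1, ContinuousLinearEquiv.symm_apply_apply]
  have h5 := hD.Phi_eq_liftAt n ε h w
  rw [h4, vertAt, h1, h2] at h5
  have h6 := hD.eta_apply t i q.1 w
  rw [h1, ContinuousLinearEquiv.symm_apply_apply] at h6
  change ((S.Phi D n ε q.1 w - circleForm q.2 ((0 : ℝ) • circleField q.2) • S.chi D q.1,
    S.eta D t q.1 w • circleField q.2) : S.TTwistor q.1 × TangentSpace (𝓡 1) q.2) = _
  rw [h3, zero_smul, sub_zero, h6, h5]
  simp only [coordField, phiFiber, kappaL_apply]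
  rfl

end SO3Structure
end CoordFields

/-! ### Brackets modulo vertical vectors -/

section Obstruction

variable {M : Type*} [TopologicalSpace M] [ChartedSpace E5 M] [IsManifold (𝓡 5) ∞ M]
namespace SO3Structure
variable {S : SO3Structure M}

/-- The trivializations of the tangent bundle are the differentials of the charts. -/
lemma frameInTriv_eq_mfderiv_extChartAt {i x₀ x : M} (hx : x ∈ (chartAt E5 x₀).source) (u : E5) :
    S.frameInTriv i x₀ x u = mfderiv (𝓡 5) 𝓘(ℝ, E5) (extChartAt (𝓡 5) x₀) x (S.frame i x u) := by
  have hb : x ∈ (trivializationAt E5 (TangentSpace (𝓡 5)) x₀).baseSet := by simpa using hx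
  rw [S.frameInTriv_apply i hb,
    ← TangentBundle.continuousLinearMapAt_trivializationAt (I := 𝓡 5) hx]
  exact (Bundle.Trivialization.continuousLinearMapAt_apply_of_mem ℝ _ hb _).symm

/-- A derivative in a vertical direction is a derivative along a curve in a fibre. -/
lemma mfderiv_liftAt_vertical {F : Type*} [NormedAddCommGroup F] [NormedSpace ℝ F] {i : M}
    {σ : S.Twistor} (h : σ.proj ∈ S.frameDomain i) {G : S.Twistor → F} {G' : F} {u : E3}
    (hG : MDifferentiableAt ((𝓡 5).prod (𝓡 2)) 𝓘(ℝ, F) G σ)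
    (hG' : HasDerivAt (fun s : ℝ => G (S.pointOf i (σ.proj, S.fiberCoordE i σ + s • u))) G' 0) :
    mfderiv ((𝓡 5).prod (𝓡 2)) 𝓘(ℝ, F) G σ (S.liftAt i σ (0, u)) = G' := by
  let c : ℝ → M × E3 := fun s => (σ.proj, S.fiberCoordE i σ + s • u)
  have hc0 : c 0 = (σ.proj, S.fiberCoordE i σ) := by simp [c]
  have hc1 : HasDerivAt (fun s : ℝ => S.fiberCoordE i σ + s • u) u 0 := by
    simpa using ((hasDerivAt_id (0 : ℝ)).smul_const u).const_add (S.fiberCoordE i σ)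
  have hc : HasMFDerivAt 𝓘(ℝ, ℝ) ((𝓡 5).prod 𝓘(ℝ, E3)) c 0
      ((0 : ℝ →L[ℝ] TangentSpace (𝓡 5) σ.proj).prod (ContinuousLinearMap.toSpanSingleton ℝ u)) :=
    (hasMFDerivAt_const σ.proj (0 : ℝ)).prodMk hc1.hasFDerivAt.hasMFDerivAt
  have hp : HasMFDerivAt ((𝓡 5).prod 𝓘(ℝ, E3)) ((𝓡 5).prod (𝓡 2)) (S.pointOf i) (c 0)
      (S.liftAt i σ) := by
    rw [hc0]
    have := (mdifferentiableAt_pointOf h).hasMFDerivAt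
    exact this
  have hGp : HasMFDerivAt ((𝓡 5).prod (𝓡 2)) 𝓘(ℝ, F) G (S.pointOf i (c 0))
      (mfderiv ((𝓡 5).prod (𝓡 2)) 𝓘(ℝ, F) G σ) := by
    rw [hc0, S.pointOf_fiberCoordE]
    exact hG.hasMFDerivAt
  have h1 := hasMFDerivAt_unique (hGp.comp (0 : ℝ) (hp.comp (0 : ℝ) hc))
    hG'.hasFDerivAt.hasMFDerivAt
  have h3 := DFunLike.congr_fun h1 (1 : ℝ)
  have h4 : mfderiv ((𝓡 5).prod (𝓡 2)) 𝓘(ℝ, F) G σ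
      (S.liftAt i σ (0, ContinuousLinearMap.toSpanSingleton ℝ u 1)) =
      ContinuousLinearMap.toSpanSingleton ℝ G' 1 := h3
  rw [ContinuousLinearMap.toSpanSingleton_apply, ContinuousLinearMap.toSpanSingleton_apply,
    one_smul, one_smul] at h4
  exact h4

/-- A chart of `M`, as a function on `𝕋 × S¹`: its differential is injective on `TM` and
annihilates the vertical vectors and `∂/∂θ`. -/
def baseChart (S : SO3Structure M) (x₀ : M) (q : S.Twistor × Circle) : E5 :=
  extChartAt (𝓡 5) x₀ q.1.proj

lemma contMDiffAt_baseChart {x₀ : M} {q : S.Twistor × Circle}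
    (hq : q.1.proj ∈ (chartAt E5 x₀).source) :
    ContMDiffAt (((𝓡 5).prod (𝓡 2)).prod (𝓡 1)) 𝓘(ℝ, E5) ∞ (S.baseChart x₀) q :=
  ContMDiffAt.comp q (contMDiffAt_extChartAt' (I := 𝓡 5) (n := ∞) (x := x₀) hq)
    ((S.contMDiff_proj q.1).comp q contMDiffAt_fst)

lemma mfderiv_baseChart {x₀ : M} {q : S.Twistor × Circle}
    (hq : q.1.proj ∈ (chartAt E5 x₀).source)
    (w : TangentSpace (((𝓡 5).prod (𝓡 2)).prod (𝓡 1)) q) :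
    mfderiv (((𝓡 5).prod (𝓡 2)).prod (𝓡 1)) 𝓘(ℝ, E5) (S.baseChart x₀) q w =
      mfderiv (𝓡 5) 𝓘(ℝ, E5) (extChartAt (𝓡 5) x₀) q.1.proj (S.dproj q.1 w.1) := by
  have h1 : HasMFDerivAt (((𝓡 5).prod (𝓡 2)).prod (𝓡 1)) 𝓘(ℝ, E5) (S.baseChart x₀) q
      ((mfderiv (𝓡 5) 𝓘(ℝ, E5) (extChartAt (𝓡 5) x₀) q.1.proj) ∘L (S.dproj q.1) ∘L
        ContinuousLinearMap.fst ℝ (S.TTwistor q.1) (TangentSpace (𝓡 1) q.2)) :=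
    (mdifferentiableAt_extChartAt (I := 𝓡 5) hq).hasMFDerivAt.comp q
      ((mdifferentiableAt_proj q.1).hasMFDerivAt.comp q (hasMFDerivAt_fst q))
  rw [h1.mfderiv]
  rfl

/-- The bracket of a vertical field `X` with `Y = ∑ bₖ Eₖ + …`: modulo vertical vectors, it is the
derivative of the components `b` along `X`. -/
lemma dproj_mlieBracket_coordField {σ : S.Twistor} {z : Circle}
    {b : S.Twistor → E5} {b' : E5} {v u : S.Twistor → E3} {g h : S.Twistor → ℝ}
    (hv : ContMDiffAt ((𝓡 5).prod (𝓡 2)) 𝓘(ℝ, E3) ∞ v σ)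
    (hg : ContMDiffAt ((𝓡 5).prod (𝓡 2)) 𝓘(ℝ, ℝ) ∞ g σ)
    (hb : ContMDiffAt ((𝓡 5).prod (𝓡 2)) 𝓘(ℝ, E5) ∞ b σ)
    (hu : ContMDiffAt ((𝓡 5).prod (𝓡 2)) 𝓘(ℝ, E3) ∞ u σ)
    (hh : ContMDiffAt ((𝓡 5).prod (𝓡 2)) 𝓘(ℝ, ℝ) ∞ h σ)
    (hb' : HasDerivAt
      (fun s : ℝ => b (S.pointOf σ.proj (σ.proj, S.fiberCoordE σ.proj σ + s • v σ))) b' 0) :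
    S.dproj σ (VectorField.mlieBracket (((𝓡 5).prod (𝓡 2)).prod (𝓡 1))
      (S.coordField σ.proj 0 v g) (S.coordField σ.proj b u h) (σ, z)).1 =
        S.frame σ.proj σ.proj b' := by
  have hi := S.mem_frameDomain σ.proj
  have hX := contMDiffAt_coordField (q := (σ, z)) hi (a := 0) contMDiffAt_const hv hg
  have hY := contMDiffAt_coordField (q := (σ, z)) hi hb hu hh
  have hs : σ.proj ∈ (chartAt E5 σ.proj).source := mem_chart_source _ _
  have hev : ∀ᶠ q in 𝓝 (σ, z), q.1.proj ∈ S.frameDomain σ.proj ∧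
      q.1.proj ∈ (chartAt E5 σ.proj).source := by
    have hc : ContinuousAt (fun q : S.Twistor × Circle => q.1.proj) (σ, z) :=
      (S.contMDiff_proj.continuous.comp continuous_fst).continuousAt
    exact hc.eventually (((S.isOpen_frameDomain σ.proj).inter
      (chartAt E5 σ.proj).open_source).mem_nhds ⟨hi, hs⟩)
  have key := mvfderiv_mlieBracket (contMDiffAt_baseChart (q := (σ, z)) hs)
    (hX.mdifferentiableAt (by simp)) (hY.mdifferentiableAt (by simp))
  have hF (a : S.Twistor → E5) (v : S.Twistor → E3) (g : S.Twistor → ℝ) :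
      (fun q => mvfderiv (((𝓡 5).prod (𝓡 2)).prod (𝓡 1)) (S.baseChart σ.proj) q
        (S.coordField σ.proj a v g q)) =ᶠ[𝓝 (σ, z)]
      (fun τ => S.frameInTriv σ.proj σ.proj τ.proj (a τ)) ∘ Prod.fst := by
    filter_upwards [hev] with q hq
    refine (mfderiv_baseChart hq.2 _).trans ?_
    rw [Function.comp_apply, frameInTriv_eq_mfderiv_extChartAt hq.2]
    exact congrArg _ (dproj_liftAt hq.1 _)
  -- the field `X` annihilates the test function
  have h0 : mvfderiv (((𝓡 5).prod (𝓡 2)).prod (𝓡 1)) (fun q =>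
      mvfderiv (((𝓡 5).prod (𝓡 2)).prod (𝓡 1)) (S.baseChart σ.proj) q
        (S.coordField σ.proj 0 v g q)) (σ, z) = 0 := by
    have e : (fun q => mvfderiv (((𝓡 5).prod (𝓡 2)).prod (𝓡 1)) (S.baseChart σ.proj) q
        (S.coordField σ.proj 0 v g q)) =ᶠ[𝓝 (σ, z)] fun _ => (0 : E5) :=
      (hF 0 v g).trans (.of_forall fun q => map_zero _)
    exact e.mfderiv_eq.trans mfderiv_const
  have hG : MDifferentiableAt ((𝓡 5).prod (𝓡 2)) 𝓘(ℝ, E5)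
      (fun τ : S.Twistor => S.frameInTriv σ.proj σ.proj τ.proj (b τ)) σ :=
    (((S.frameInTriv_contMDiffAt hi).comp σ (S.contMDiff_proj σ)).clm_apply hb).mdifferentiableAt
      (by simp)
  have h1 : mvfderiv (((𝓡 5).prod (𝓡 2)).prod (𝓡 1)) (fun q =>
      mvfderiv (((𝓡 5).prod (𝓡 2)).prod (𝓡 1)) (S.baseChart σ.proj) q
        (S.coordField σ.proj b u h q)) (σ, z) (S.coordField σ.proj 0 v g (σ, z)) =
      S.frameInTriv σ.proj σ.proj σ.proj b' := by
    have h2 := (hG.hasMFDerivAt.comp (σ, z) (hasMFDerivAt_fst (I := (𝓡 5).prod (𝓡 2))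
      (I' := 𝓡 1) (σ, z))).mfderiv
    have h3 := mfderiv_liftAt_vertical hi hG (u := v σ)
      ((S.frameInTriv σ.proj σ.proj σ.proj).hasFDerivAt.comp_hasDerivAt (0 : ℝ) hb')
    have h4 := (hF b u h).mfderiv_eq (I := ((𝓡 5).prod (𝓡 2)).prod (𝓡 1)) (I' := 𝓘(ℝ, E5))
    refine (DFunLike.congr_fun (h4.trans h2) (S.coordField σ.proj 0 v g (σ, z))).trans ?_
    have h5 : (S.frame σ.proj σ.proj) ((0 : S.Twistor → E5) σ) = 0 := map_zero _
    change mfderiv ((𝓡 5).prod (𝓡 2)) 𝓘(ℝ, E5) _ σ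
      (S.liftAt σ.proj σ (S.frame σ.proj σ.proj ((0 : S.Twistor → E5) σ), v σ)) = _
    rw [h5]
    exact h3
  rw [h0, h1] at key
  have h2 := (mfderiv_baseChart (S := S) (q := (σ, z)) hs _).symm.trans (key.trans (sub_zero _))
  rw [frameInTriv_eq_mfderiv_extChartAt hs] at h2
  exact (isInvertible_mfderiv_extChartAt (I := 𝓡 5) (mem_extChartAt_source σ.proj)).injective h2

end SO3Structure
end Obstruction

/-! ### Failure of normality -/

section Normality

variable {M : Type*} [TopologicalSpace M] [ChartedSpace E5 M] [IsManifold (𝓡 5) ∞ M]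
namespace SO3Structure
variable {S : SO3Structure M}

/-- The derivative of `φ` in the vertical direction `w`. -/
lemma hasDerivAt_phi_pointOf (ε : ℝ) (i : M) (σ : S.Twistor) {w : E3}
    (hw : ⟪S.fiberCoordE i σ, w⟫_ℝ = 0) (a : E5) :
    HasDerivAt (fun s : ℝ => phi ε (kappa (S.fiberCoordE i
      (S.pointOf i (σ.proj, S.fiberCoordE i σ + s • w)))) a) (dPhi ε (S.fiberCoordE i σ) w a) 0 := by
  have hy := S.norm_fiberCoordE i σ
  set y := S.fiberCoordE i σ with hdef
  have h1 : HasDerivAt (fun s : ℝ => y + s • w) w 0 := by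
    simpa using ((hasDerivAt_id (0 : ℝ)).smul_const w).const_add y
  have hd : HasFDerivAt (fun v => (toSphere v : E3))
      (fderiv ℝ (fun v => (toSphere v : E3)) y) (y + (0 : ℝ) • w) := by
    rw [zero_smul, add_zero]
    exact (differentiableAt_coe_toSphere (S.fiberCoordE_ne_zero i σ)).hasFDerivAt
  have h2 := hd.comp_hasDerivAt (0 : ℝ) h1
  rw [fderiv_coe_toSphere hy hw] at h2
  have h3 := hasDerivAt_phi_kappa ε (c := fun s : ℝ => (toSphere (y + s • w) : E3))
    (fun s => mem_sphere_zero_iff_norm.1 (toSphere (y + s • w)).2) h2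
  have h0 : (toSphere (y + (0 : ℝ) • w) : E3) = y := by
    rw [zero_smul, add_zero, ← S.fiberCoordE_pointOf i (σ.proj, y), hdef, S.pointOf_fiberCoordE]
  simp only [h0] at h3
  have h4 := h3.clm_apply (hasDerivAt_const (0 : ℝ) a)
  simpa only [S.fiberCoordE_pointOf, map_zero, add_zero] using h4

/-- Modulo vertical vectors and `ξ`, the almost complex structure acts by `φ`. -/
lemma dproj_inducedJ (D : Cov M) (n : ℕ) (ε t : ℝ) {σ : S.Twistor} {z : Circle}
    {w : TangentSpace (((𝓡 5).prod (𝓡 2)).prod (𝓡 1)) ((σ, z) : S.Twistor × Circle)} {a : E5}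
    (hw : S.dproj σ w.1 = S.frame σ.proj σ.proj a) : ∃ c : ℝ,
    S.dproj σ (inducedJ ((𝓡 5).prod (𝓡 2)) (S.Phi D n ε) (S.chi D) (S.eta D t) (σ, z) w).1 =
      S.frame σ.proj σ.proj (phi ε (kappa (S.fiberCoordE σ.proj σ)) a -
        c • xi (kappa (S.fiberCoordE σ.proj σ))) := by
  have key (X : S.TTwistor σ) (c : ℝ) (hX : S.dproj σ X = S.frame σ.proj σ.proj a) :
      S.dproj σ (S.Phi D n ε σ X - c • S.chi D σ) = S.frame σ.proj σ.proj
        (phi ε (kappa (S.fiberCoordE σ.proj σ)) a - c • xi (kappa (S.fiberCoordE σ.proj σ))) := by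
    rw [map_sub, map_smul, dproj_Phi (i := σ.proj), hX, chi, dproj_hLift, S.point_eq, map_sub,
      map_smul, ContinuousLinearEquiv.symm_apply_apply]
  exact ⟨circleForm z w.2, key w.1 _ hw⟩

/-- `Φ` acts on vertical vectors by the vector product with `±σ`. -/
lemma phiFiber_zero (D : Cov M) (n : ℕ) (ε : ℝ) (i : M) (v : S.Twistor → E3) (σ : S.Twistor) :
    S.phiFiber D n ε i 0 v σ = (-1 : ℝ) ^ n • cross (S.fiberCoordE i σ) (v σ) := by
  have h := kappa_commutator (S.fiberCoordE i σ) (v σ)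
  have h' : kappa (v σ) * kappa (S.fiberCoordE i σ) - kappa (S.fiberCoordE i σ) * kappa (v σ) =
      kappa (cross (S.fiberCoordE i σ) (v σ)) := by
    rw [← neg_sub]; exact neg_eq_iff_eq_neg.2 h
  simp only [phiFiber, Pi.zero_apply, map_zero, zero_mul, mul_zero, sub_zero, add_zero,
    kappaL_apply, map_smul, h']
  exact congrArg _ (kappaCoord_kappa _)

/-- If the structure is normal, then the obstruction vanishes up to multiples of `ξ`, by the Nijenhuis
bracket at the point `κ₃` of a vertical field `A` and the field `B` with components `e_k`. -/
lemma IsSO3Connection.obstruction_eq_zero [T2Space M] {D : Cov M} (hD : S.IsSO3Connection D)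
    (hD' : CovariantDerivative.ContMDiffCovariantDerivative D ∞) (n : ℕ) (ε t : ℝ)
    (hN : IsNormal ((𝓡 5).prod (𝓡 2)) (S.Phi D n ε) (S.chi D) (S.eta D t)) {σ : S.Twistor}
    (hσ : S.fiberCoordE σ.proj σ = EuclideanSpace.single 2 1) (k : Fin 5) :
    obstruction ε ((-1 : ℝ) ^ n) (stdVec k) 2 = 0 := by
  let i := σ.proj
  have hi : σ.proj ∈ S.frameDomain i := S.mem_frameDomain σ.proj
  let U : Set (S.Twistor × Circle) := {q | q.1.proj ∈ S.frameDomain i}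
  have hU : IsOpen U := (S.isOpen_frameDomain i).preimage
    (S.contMDiff_proj.continuous.comp continuous_fst)
  let p : S.Twistor × Circle := (σ, 1)
  have hp : p ∈ U := hi
  -- the vertical field `A` takes the value `κ₃ × (-κ₂) = κ₁` at `κ₃`
  let v : S.Twistor → E3 := fun τ => cross (S.fiberCoordE i τ) (-EuclideanSpace.single 1 1)
  let e : S.Twistor → E5 := fun _ => stdVec k
  have hv {τ : S.Twistor} (hτ : τ.proj ∈ S.frameDomain i) :
      ContMDiffAt ((𝓡 5).prod (𝓡 2)) 𝓘(ℝ, E3) ∞ v τ := by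
    have hc : ContDiff ℝ ∞ (fun y : E3 => cross y (-EuclideanSpace.single 1 1)) := by
      simp only [cross_apply]
      rw [contDiff_piLp]
      intro k
      fin_cases k <;> simp <;> fun_prop
    exact hc.contMDiff.contMDiffAt.comp τ (S.contMDiffAt_fiberCoordE hτ)
  have hvσ : v σ = EuclideanSpace.single 0 1 := by
    simp only [v, i, hσ, cross_apply]
    ext j; fin_cases j <;> simp
  have h0 {F : Type} [NormedAddCommGroup F] [NormedSpace ℝ F] (x : F) (τ : S.Twistor) :
    ContMDiffAt ((𝓡 5).prod (𝓡 2)) 𝓘(ℝ, F) ∞ (fun _ : S.Twistor => x) τ := contMDiffAt_const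
  let A := S.coordField i 0 v 0
  let B := S.coordField i e 0 0
  have hNij := hN U A B hU
    (fun q hq => (contMDiffAt_coordField hq (h0 0 _) (hv hq) (h0 0 _)).contMDiffWithinAt)
    (fun q hq => (contMDiffAt_coordField hq (h0 _ _) (h0 0 _) (h0 0 _)).contMDiffWithinAt) p hp
  -- the fields `JA` and `JB` in coordinates
  let b : S.Twistor → E5 := fun τ => phi ε (kappa (S.fiberCoordE i τ)) (stdVec k)
  let vA := S.phiFiber D n ε i 0 v
  let vB := S.phiFiber D n ε i e 0
  let gB : S.Twistor → ℝ := fun τ => ⟪e τ, xi (kappa (S.fiberCoordE i τ))⟫_ℝ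
  have hJA : (fun q => inducedJ ((𝓡 5).prod (𝓡 2)) (S.Phi D n ε) (S.chi D) (S.eta D t) q (A q))
      =ᶠ[𝓝 p] S.coordField i 0 vA 0 := by
    filter_upwards [hU.mem_nhds hp] with q hq
    have h1 : (fun τ : S.Twistor => phi ε (kappa (S.fiberCoordE i τ)) ((0 : S.Twistor → E5) τ)) =
        0 := funext fun _ => map_zero _
    have h2 : (fun τ : S.Twistor => ⟪(0 : S.Twistor → E5) τ, xi (kappa (S.fiberCoordE i τ))⟫_ℝ) =
        0 := funext fun _ => inner_zero_left _
    have := hD.inducedJ_coordField n ε t (a := 0) (v := v) hq (inner_cross_self _ _)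
    rwa [h1, h2] at this
  have hJB : (fun q => inducedJ ((𝓡 5).prod (𝓡 2)) (S.Phi D n ε) (S.chi D) (S.eta D t) q (B q))
      =ᶠ[𝓝 p] S.coordField i b vB gB := by
    filter_upwards [hU.mem_nhds hp] with q hq
    exact hD.inducedJ_coordField n ε t (v := 0) hq (inner_zero_right _)
  have hvA := contMDiffAt_phiFiber hD' n ε hi (h0 0 σ) (hv hi)
  have hvB := contMDiffAt_phiFiber hD' n ε hi (h0 (stdVec k) σ) (h0 0 σ)
  have hb := contMDiffAt_phi_apply ε hi (h0 (stdVec k) σ)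
  have hgB := contMDiffAt_inner_xi hi (h0 (stdVec k) σ)
  have hvAσ : vA σ = (-1 : ℝ) ^ n • EuclideanSpace.single 1 1 := by
    simp only [vA, phiFiber_zero, hvσ, i, hσ, cross_apply]
    congr 1
    ext j; fin_cases j <;> simp
  have orth (j : Fin 3) (hj : j ≠ 2) (c : ℝ) :
      ⟪S.fiberCoordE i σ, c • EuclideanSpace.single j (1 : ℝ)⟫_ℝ = 0 := by
    rw [hσ, inner_smul_right, EuclideanSpace.inner_single_left]
    simp [hj.symm]
  -- the brackets modulo vertical vectors and `∂/∂θ`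
  have d1 := hasDerivAt_phi_pointOf ε i σ (w := vA σ) (by rw [hvAσ]; exact orth 1 (by decide) _)
    (stdVec k)
  have d3 := hasDerivAt_phi_pointOf ε i σ (w := v σ)
    (by simpa only [hvσ, one_smul] using orth 0 (by decide) 1) (stdVec k)
  have b1 := dproj_mlieBracket_coordField (z := 1) (v := vA) (g := 0) (b := b) (u := vB) (h := gB)
    hvA (h0 0 σ) hb hvB hgB d1
  have b2 := dproj_mlieBracket_coordField (z := 1) (v := vA) (g := 0) (b := e) (u := 0) (h := 0)
    hvA (h0 0 σ) (h0 (stdVec k) σ) (h0 0 σ) (h0 0 σ) (hasDerivAt_const _ _)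
  have b3 := dproj_mlieBracket_coordField (z := 1) (v := v) (g := 0) (b := b) (u := vB) (h := gB)
    (hv hi) (h0 0 σ) hb hvB hgB d3
  have b4 := dproj_mlieBracket_coordField (z := 1) (v := v) (g := 0) (b := e) (u := 0) (h := 0)
    (hv hi) (h0 0 σ) (h0 (stdVec k) σ) (h0 0 σ) (h0 0 σ) (hasDerivAt_const _ _)
  obtain ⟨c2, j2⟩ := dproj_inducedJ D n ε t b2
  obtain ⟨c3, j3⟩ := dproj_inducedJ D n ε t b3
  rw [nijenhuis, hJA.mlieBracket_vectorField_eq hJB,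
    hJA.mlieBracket_vectorField_eq (W₁ := B) (W := B) (.of_forall fun _ => rfl),
    Filter.EventuallyEq.mlieBracket_vectorField_eq (V₁ := A) (V := A) (.of_forall fun _ => rfl)
      hJB] at hNij
  have split (w₁ w₂ w₃ w₄ : S.TTwistor σ × TangentSpace (𝓡 1) (1 : Circle))
      (h : w₁ - w₂ - w₃ - w₄ = 0) :
      S.dproj σ w₁.1 - S.dproj σ w₂.1 - S.dproj σ w₃.1 - S.dproj σ w₄.1 = 0 := by
    rw [← map_sub, ← map_sub, ← map_sub]
    exact (congrArg (fun w => S.dproj σ w.1) h).trans (map_zero _)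
  have hz := split _ _ _ _ hNij
  rw [b1, j2, j3, b4, ← map_sub, ← map_sub, ← map_sub] at hz
  have hz' := (S.frame σ.proj σ.proj).map_eq_zero_iff.1 hz
  refine obstruction_apply_eq_zero (ε := ε) (x := stdVec k) (c₂ := c2) (c₃ := c3) hσ hvAσ hvσ ?_
  convert hz' using 1

/-- The point `κ₃` over any point of `M` shows that the structure is not normal. -/
lemma IsSO3Connection.not_isNormal [T2Space M] [Nonempty M] {D : Cov M}
    (hD : S.IsSO3Connection D) (hD' : CovariantDerivative.ContMDiffCovariantDerivative D ∞) (t : ℝ)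
    {n : ℕ} {ε : ℝ} (h : (ε = -1 ∧ (-1 : ℝ) ^ n = -1) ∨ (ε = 1 ∧ (-1 : ℝ) ^ n = 1) ∨
      (ε = -1 ∧ (-1 : ℝ) ^ n = 1)) :
    ¬ IsNormal ((𝓡 5).prod (𝓡 2)) (S.Phi D n ε) (S.chi D) (S.eta D t) := by
  intro hN
  obtain ⟨x⟩ := ‹Nonempty M›
  let σ : S.Twistor := S.pointOf x (x, EuclideanSpace.single 2 1)
  have hσ : S.fiberCoordE σ.proj σ = EuclideanSpace.single 2 1 := by
    have h := S.fiberCoordE_pointOf x (x, EuclideanSpace.single 2 1)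
    rw [coe_toSphere (by simp)] at h
    exact h.trans (by simp)
  obtain ⟨k, hk⟩ := obstruction_ne_zero h
  exact hk (hD.obstruction_eq_zero hD' n ε t hN hσ k)

end SO3Structure
end Normality

end
end SO3Twistor

theorem mainTheorem2 {M : Type*} [TopologicalSpace M] [T2Space M] [SecondCountableTopology M]
    [ChartedSpace SO3Twistor.E5 M] [IsManifold (𝓡 5) ∞ M] [Nonempty M]
    (S : SO3Twistor.SO3Structure M)
    (D : CovariantDerivative (𝓡 5) SO3Twistor.E5 (fun x : M => TangentSpace (𝓡 5) x))
    [CovariantDerivative.ContMDiffCovariantDerivative D ∞] (hD : S.IsSO3Connection D)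
    (t : ℝ) (ht : 0 < t) :
    ¬ SO3Twistor.IsNormal ((𝓡 5).prod (𝓡 2)) (S.Phi D 1 (-1)) (S.chi D) (S.eta D t) ∧
    ¬ SO3Twistor.IsNormal ((𝓡 5).prod (𝓡 2)) (S.Phi D 2 1) (S.chi D) (S.eta D t) ∧
    ¬ SO3Twistor.IsNormal ((𝓡 5).prod (𝓡 2)) (S.Phi D 2 (-1)) (S.chi D) (S.eta D t) := by
  have hD' : CovariantDerivative.ContMDiffCovariantDerivative D ∞ := inferInstance
  exact ⟨hD.not_isNormal hD' t (by norm_num), hD.not_isNormal hD' t (by norm_num),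
    hD.not_isNormal hD' t (by norm_num)⟩
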